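/- **Setting.** Let $\mathcal{A}$ be an abelian category, $F\colon\mathcal{A}\to\mathcal{A}$ an exact functor, $\eta\colon F\to\mathrm{id}_{\mathcal{A}}$ a natural transformation and $p\ge 2$ an integer. Assume that $\mathcal{A}$ has enough objects on which $\eta$ is a monomorphism: for every $X\in\mathcal{A}$ there is an epimorphism $M\twoheadrightarrow X$ such that $\eta(M)\colon FM\to M$ is a monomorphism. The category $\mathcal{A}[\eta^{1/p}]$ has as objects the sequences $$FM_p\xrightarrow{f_1}M_1\xrightarrow{f_2}\cdots\xrightarrow{f_p}M_p$$ in $\mathcal{A}$ such that for each $1\le i\le p$ the composition $FM_i\xrightarrow{Ff_{i+1}}\cdots\xrightarrow{Ff_p}FM_p\xrightarrow{f_1}M_1\to\cdots\xrightarrow{f_i}M_i$ equals $\eta(M_i)$. A morphism $(M_i,f_i)\to(N_i,g_i)$ is a family of morphisms $\varphi_i\colon M_i\to N_i$ commuting with all structure maps (where the component at $FM_p$ is $F\varphi_p$). The same definition applies to $p=1$, and to $F=0$, $\eta=0$ on any abelian category $\mathcal{B}$; in the latter case the category is written $\mathcal{B}[0^{1/p}]$. Let $\mathcal{A}_\eta$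 be the full subcategory of $\mathcal{A}$ of the objects $M$ with $\eta(M)=0$. All these categories are abelian. The global dimension $\operatorname{gldim}\mathcal{B}\in\{-\infty\}\cup\mathbb{N}\cup\{\infty\}$ of an abelian category $\mathcal{B}$ is the supremum of all $n\geq 0$ such that $\operatorname{Ext}^n_{\mathcal{B}}(X,Y)\ne 0$ for some $X,Y\in\mathcal{B}$ (so it is $-\infty$ exactly when $\mathcal{B}=0$). **Theorem.** Suppose moreover that $F$ is an autoequivalence. Then $$\operatorname{gldim}\mathcal{A}[\eta^{1/p}]=\max\{\operatorname{gldim}\mathcal{A},\ \operatorname{gldim}\mathcal{A}_\eta+1\}.$$ Furthermore $$\operatorname{gldim}\mathcal{A}_\eta[0^{1/(p-1)}]\le\operatorname{gldim}\mathcal{A}_\eta+1,$$ and more generally $\operatorname{gldim}\mathcal{B}[0^{1/(p-1)}]\le\operatorname{gldim}\mathcal{B}+1$ for every abelian category $\mathcal{B}$. -/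

import Mathlib

open CategoryTheory CategoryTheory.Limits

universe v u

/-! ### Global dimension -/

/-- The global dimension of an abelian category: the supremum of the projective dimensions of its
objects, where the projective dimension of `X` is the least `n` with `Ext X Y i = 0` for all `i > n`
and all `Y`.  It takes values in `{-∞} ∪ ℕ ∪ {∞}`, and is `-∞ = ⊥` exactly for the zero category. -/
noncomputable def globalDimension (C : Type u) [Category.{v} C] [Abelian C] : WithBot ℕ∞ :=
  ⨆ X : C, projectiveDimension X

/-! ### The category `𝒜[η^{1/p}]` -/

section Root

variable {C : Type u} [Category.{v} C]

/-- An object of `𝒜[η^{1/p}]`: a sequence `M₁ ⟶ ⋯ ⟶ M_p` in `𝒜` (a functor on the linearly ordered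
set `Fin p`, so that `M_i` is the value at `i - 1`) together with a morphism `f₁ : F M_p ⟶ M₁`, such
that for all `i` the composition
`F M_i ⟶ F M_p ⟶ M₁ ⟶ M_i` is equal to `η(M_i)`. -/
structure RootObj (F : C ⥤ C) (η : F ⟶ 𝟭 C) (p : ℕ) [NeZero p] where
  /-- the sequence `M₁ ⟶ ⋯ ⟶ M_p` -/
  seq : Fin p ⥤ C
  /-- the morphism `f₁ : F M_p ⟶ M₁` -/
  conn : F.obj (seq.obj ⊤) ⟶ seq.obj ⊥
  /-- the cycle condition -/
  cycle : ∀ i : Fin p,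
    F.map (seq.map (homOfLE le_top)) ≫ conn ≫ seq.map (homOfLE bot_le) = η.app (seq.obj i)

namespace RootObj

variable {F : C ⥤ C} {η : F ⟶ 𝟭 C} {p : ℕ} [NeZero p]

/-- A morphism in `𝒜[η^{1/p}]`: morphisms `φ_i : M_i ⟶ N_i` commuting with all structure maps. -/
@[ext]
structure Hom (M N : RootObj F η p) where
  /-- the components `φ_i : M_i ⟶ N_i`, natural in `i` -/
  seq : M.seq ⟶ N.seq
  /-- compatibility with `f₁` -/
  comm : F.map (seq.app ⊤) ≫ N.conn = M.conn ≫ seq.app ⊥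

lemma Hom.comm_assoc {M N : RootObj F η p} (f : Hom M N) {Z : C} (h : N.seq.obj ⊥ ⟶ Z) :
    F.map (f.seq.app ⊤) ≫ N.conn ≫ h = M.conn ≫ f.seq.app ⊥ ≫ h := by
  rw [← Category.assoc, f.comm, Category.assoc]

instance : Category.{v} (RootObj F η p) where
  Hom M N := Hom M N
  id M := { seq := 𝟙 _, comm := by simp }
  comp f g :=
    { seq := f.seq ≫ g.seq
      comm := by simp [Hom.comm, Hom.comm_assoc] }
  id_comp f := by apply Hom.ext; exact Category.id_comp _
  comp_id f := by apply Hom.ext; exact Category.comp_id _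
  assoc f g h := by apply Hom.ext; exact Category.assoc _ _ _

@[ext]
lemma hom_ext {M N : RootObj F η p} {f g : M ⟶ N} (h : f.seq = g.seq) : f = g := Hom.ext h

@[simp] lemma id_seq (M : RootObj F η p) : Hom.seq (𝟙 M) = 𝟙 M.seq := rfl

@[simp] lemma comp_seq {M N K : RootObj F η p} (f : M ⟶ N) (g : N ⟶ K) :
    Hom.seq (f ≫ g) = f.seq ≫ g.seq := rfl

variable (F η p) in
/-- The functor forgetting the morphism `f₁`. -/
@[simps]
def forget : RootObj F η p ⥤ (Fin p ⥤ C) where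
  obj M := M.seq
  map f := f.seq

instance : (forget F η p).Faithful where
  map_injective h := hom_ext h

instance : (forget F η p).ReflectsIsomorphisms where
  reflects {M N} f hf := by
    let g : N.seq ⟶ M.seq := @inv _ _ _ _ ((forget F η p).map f) hf
    have h₁ : f.seq ≫ g = 𝟙 _ := @IsIso.hom_inv_id _ _ _ _ ((forget F η p).map f) hf
    have h₂ : g ≫ f.seq = 𝟙 _ := @IsIso.inv_hom_id _ _ _ _ ((forget F η p).map f) hf
    refine ⟨⟨{ seq := g, comm := ?_ }, hom_ext h₁, hom_ext h₂⟩⟩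
    have h₁' : f.seq.app ⊥ ≫ g.app ⊥ = 𝟙 _ := congrArg (fun t => t.app ⊥) h₁
    have h₂' : F.map (g.app ⊤) ≫ F.map (f.seq.app ⊤) = 𝟙 _ := by
      rw [← F.map_comp, ← NatTrans.comp_app, h₂, NatTrans.id_app, F.map_id]
    calc F.map (g.app ⊤) ≫ M.conn
        = F.map (g.app ⊤) ≫ M.conn ≫ f.seq.app ⊥ ≫ g.app ⊥ := by rw [h₁', Category.comp_id]
      _ = F.map (g.app ⊤) ≫ F.map (f.seq.app ⊤) ≫ N.conn ≫ g.app ⊥ := by rw [← f.comm_assoc]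
      _ = N.conn ≫ g.app ⊥ := by rw [reassoc_of% h₂']

/-! #### The abelian structure (everything is computed componentwise) -/

section Preadditive

variable [Preadditive C] [F.Additive]

instance (M N : RootObj F η p) : Zero (M ⟶ N) := ⟨{ seq := 0, comm := by simp }⟩
instance (M N : RootObj F η p) : Add (M ⟶ N) :=
  ⟨fun f g => { seq := f.seq + g.seq, comm := by simp [Functor.map_add, f.comm, g.comm] }⟩
instance (M N : RootObj F η p) : Neg (M ⟶ N) :=
  ⟨fun f => { seq := -f.seq, comm := by simp [Functor.map_neg, f.comm] }⟩

@[simp] lemma zero_seq (M N : RootObj F η p) : Hom.seq (0 : M ⟶ N) = 0 := rfl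
@[simp] lemma add_seq {M N : RootObj F η p} (f g : M ⟶ N) : (f + g).seq = f.seq + g.seq := rfl
@[simp] lemma neg_seq {M N : RootObj F η p} (f : M ⟶ N) : (-f).seq = -f.seq := rfl

instance (M N : RootObj F η p) : AddCommGroup (M ⟶ N) where
  add_assoc f g h := by ext1; simp [add_assoc]
  zero_add f := by ext1; simp
  add_zero f := by ext1; simp
  nsmul := nsmulRec
  zsmul := zsmulRec
  neg_add_cancel f := by ext1; simp
  add_comm f g := by ext1; simp [add_comm]

instance : Preadditive (RootObj F η p) where
  add_comp M N K f f' g := by ext1; simp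
  comp_add M N K f g g' := by ext1; simp

instance : (forget F η p).Additive where

end Preadditive

section Auxiliary

lemma lift_cycle {S : Fin p ⥤ C} (k : F.obj (S.obj ⊤) ⟶ S.obj ⊥) (N : RootObj F η p)
    (a : S ⟶ N.seq) (h : k ≫ a.app ⊥ = F.map (a.app ⊤) ≫ N.conn) (i : Fin p) :
    (F.map (S.map (homOfLE (le_top : i ≤ ⊤))) ≫ k ≫ S.map (homOfLE (bot_le : ⊥ ≤ i))) ≫ a.app i =
      η.app (S.obj i) ≫ a.app i := by
  have h₃ : F.map (a.app i) ≫ η.app (N.seq.obj i) = η.app (S.obj i) ≫ a.app i :=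
    η.naturality (a.app i)
  rw [← h₃, Category.assoc, Category.assoc, a.naturality, reassoc_of% h, ← F.map_comp_assoc,
    a.naturality, F.map_comp_assoc, ← N.cycle i]

lemma desc_cycle {S : Fin p ⥤ C} (k : F.obj (S.obj ⊤) ⟶ S.obj ⊥) (N : RootObj F η p)
    (a : N.seq ⟶ S) (h : F.map (a.app ⊤) ≫ k = N.conn ≫ a.app ⊥) (i : Fin p) :
    F.map (a.app i) ≫ F.map (S.map (homOfLE (le_top : i ≤ ⊤))) ≫ k ≫
      S.map (homOfLE (bot_le : ⊥ ≤ i)) = F.map (a.app i) ≫ η.app (S.obj i) := by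
  have h₃ : F.map (a.app i) ≫ η.app (S.obj i) = η.app (N.seq.obj i) ≫ a.app i :=
    η.naturality (a.app i)
  rw [h₃, ← F.map_comp_assoc, ← a.naturality, F.map_comp_assoc, reassoc_of% h, ← a.naturality,
    ← N.cycle i, Category.assoc, Category.assoc]

lemma lift_comm {S T N : RootObj F η p} (l : S.seq ⟶ T.seq) (g : T ⟶ N) (h : S ⟶ N)
    (w : l ≫ g.seq = h.seq) :
    (F.map (l.app ⊤) ≫ T.conn) ≫ g.seq.app ⊥ = (S.conn ≫ l.app ⊥) ≫ g.seq.app ⊥ := by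
  rw [Category.assoc, Category.assoc, ← g.comm, ← F.map_comp_assoc, ← NatTrans.comp_app,
    ← NatTrans.comp_app, w, h.comm]

lemma desc_comm {S T N : RootObj F η p} (l : S.seq ⟶ T.seq) (g : N ⟶ S) (h : N ⟶ T)
    (w : g.seq ≫ l = h.seq) :
    F.map (g.seq.app ⊤) ≫ F.map (l.app ⊤) ≫ T.conn =
      F.map (g.seq.app ⊤) ≫ S.conn ≫ l.app ⊥ := by
  rw [g.comm_assoc, ← F.map_comp_assoc, ← NatTrans.comp_app, ← NatTrans.comp_app, w, h.comm]

end Auxiliary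

section Limits

variable {J : Type} [SmallCategory J] [HasLimitsOfShape J C] (D : J ⥤ RootObj F η p)

/-- The limit of a diagram in `𝒜[η^{1/p}]`, computed componentwise. -/
noncomputable def limitLift (c : Cone (D ⋙ forget F η p)) (hc : IsLimit c) :
    LiftsToLimit D (forget F η p) c hc :=
  let hb : ∀ i : Fin p, IsLimit (((evaluation (Fin p) C).obj i).mapCone c) :=
    fun _ => isLimitOfPreserves _ hc
  let a : ∀ j, c.pt ⟶ (D.obj j).seq := fun j => c.π.app j
  let s : Cone ((D ⋙ forget F η p) ⋙ (evaluation (Fin p) C).obj ⊥) :=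
    { pt := F.obj (c.pt.obj ⊤)
      π :=
        { app := fun j => F.map ((a j).app ⊤) ≫ (D.obj j).conn
          naturality := fun j k f => by
            have h : a j ≫ (D.map f).seq = a k := c.w f
            change 𝟙 _ ≫ F.map ((a k).app ⊤) ≫ (D.obj k).conn =
              (F.map ((a j).app ⊤) ≫ (D.obj j).conn) ≫ (D.map f).seq.app ⊥
            rw [Category.id_comp, ← h, NatTrans.comp_app, F.map_comp, Category.assoc,
              Category.assoc, (D.map f).comm] } }
  have hs : ∀ j, (hb ⊥).lift s ≫ (a j).app ⊥ = F.map ((a j).app ⊤) ≫ (D.obj j).conn :=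
    fun j => (hb ⊥).fac s j
  let L : RootObj F η p :=
    { seq := c.pt
      conn := (hb ⊥).lift s
      cycle := fun i => (hb i).hom_ext fun j => lift_cycle _ (D.obj j) (a j) (hs j) i }
  let b : ∀ j, L ⟶ D.obj j := fun j => { seq := a j, comm := (hs j).symm }
  let lc : Cone D :=
    { pt := L
      π :=
        { app := b
          naturality := fun _ _ f => hom_ext (c.π.naturality f) } }
  { liftedCone := lc
    validLift := Cone.ext (Iso.refl _) (fun _ => (Category.id_comp _).symm)
    makesLimit :=
      { lift := fun t =>
          { seq := hc.lift ((forget F η p).mapCone t)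
            comm := (hb ⊥).hom_ext fun j => lift_comm (S := t.pt) (T := L)
              (hc.lift ((forget F η p).mapCone t)) (b j) (t.π.app j) (hc.fac _ j) }
        fac := fun t j => hom_ext (hc.fac ((forget F η p).mapCone t) j)
        uniq := fun t m hm => hom_ext
          (hc.uniq ((forget F η p).mapCone t) m.seq fun j => congrArg Hom.seq (hm j)) } }

noncomputable instance : CreatesLimitsOfShape J (forget F η p) where
  CreatesLimit {D} := createsLimitOfReflectsIso (limitLift D)

instance : HasLimitsOfShape J (RootObj F η p) :=
  hasLimitsOfShape_of_hasLimitsOfShape_createsLimitsOfShape (forget F η p)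

end Limits

section Colimits

variable {J : Type} [SmallCategory J] [HasColimitsOfShape J C] [PreservesColimitsOfShape J F]
  (D : J ⥤ RootObj F η p)

/-- The colimit of a diagram in `𝒜[η^{1/p}]`, computed componentwise. -/
noncomputable def colimitLift (c : Cocone (D ⋙ forget F η p)) (hc : IsColimit c) :
    LiftsToColimit D (forget F η p) c hc :=
  let hb : ∀ i : Fin p, IsColimit (F.mapCocone (((evaluation (Fin p) C).obj i).mapCocone c)) :=
    fun _ => isColimitOfPreserves _ (isColimitOfPreserves _ hc)
  let a : ∀ j, (D.obj j).seq ⟶ c.pt := fun j => c.ι.app j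
  let s : Cocone (((D ⋙ forget F η p) ⋙ (evaluation (Fin p) C).obj ⊤) ⋙ F) :=
    { pt := c.pt.obj ⊥
      ι :=
        { app := fun j => (D.obj j).conn ≫ (a j).app ⊥
          naturality := fun j k f => by
            have h : (D.map f).seq ≫ a k = a j := c.w f
            change F.map ((D.map f).seq.app ⊤) ≫ (D.obj k).conn ≫ (a k).app ⊥ =
              ((D.obj j).conn ≫ (a j).app ⊥) ≫ 𝟙 _
            rw [Category.comp_id, ← h, NatTrans.comp_app, (D.map f).comm_assoc] } }
  have hs : ∀ j, F.map ((a j).app ⊤) ≫ (hb ⊤).desc s = (D.obj j).conn ≫ (a j).app ⊥ :=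
    fun j => (hb ⊤).fac s j
  let L : RootObj F η p :=
    { seq := c.pt
      conn := (hb ⊤).desc s
      cycle := fun i => (hb i).hom_ext fun j => desc_cycle _ (D.obj j) (a j) (hs j) i }
  let b : ∀ j, D.obj j ⟶ L := fun j => { seq := a j, comm := hs j }
  let lc : Cocone D :=
    { pt := L
      ι :=
        { app := b
          naturality := fun _ _ f => hom_ext (c.ι.naturality f) } }
  { liftedCocone := lc
    validLift := Cocone.ext (Iso.refl _) (fun _ => Category.comp_id _)
    makesColimit :=
      { desc := fun t =>
          { seq := hc.desc ((forget F η p).mapCocone t)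
            comm := (hb ⊤).hom_ext fun j => desc_comm (S := L) (T := t.pt)
              (hc.desc ((forget F η p).mapCocone t)) (b j) (t.ι.app j) (hc.fac _ j) }
        fac := fun t j => hom_ext (hc.fac ((forget F η p).mapCocone t) j)
        uniq := fun t m hm => hom_ext
          (hc.uniq ((forget F η p).mapCocone t) m.seq fun j => congrArg Hom.seq (hm j)) } }

noncomputable instance : CreatesColimitsOfShape J (forget F η p) where
  CreatesColimit {D} := createsColimitOfReflectsIso (colimitLift D)

instance : HasColimitsOfShape J (RootObj F η p) :=
  hasColimitsOfShape_of_hasColimitsOfShape_createsColimitsOfShape (forget F η p)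

end Colimits

section Abelian

variable [Abelian C] [F.Additive] [PreservesFiniteColimits F]

instance : HasFiniteLimits (RootObj F η p) := ⟨fun _ _ _ => inferInstance⟩
instance : HasFiniteColimits (RootObj F η p) := ⟨fun _ _ _ => inferInstance⟩
instance : PreservesFiniteLimits (forget F η p) := ⟨fun _ _ _ => inferInstance⟩
instance : PreservesFiniteColimits (forget F η p) := ⟨fun _ _ _ => inferInstance⟩

instance : IsNormalEpiCategory (RootObj F η p) where
  normalEpiOfEpi f _ := ⟨NormalEpi.mk _ (kernel.ι f) (kernel.condition _)
    (isColimitOfReflects (forget F η p) (Abelian.isColimitMapCoconeOfCokernelCoforkOfπ _ _))⟩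

instance : IsNormalMonoCategory (RootObj F η p) where
  normalMonoOfMono f _ := ⟨NormalMono.mk _ (cokernel.π f) (cokernel.condition _)
    (isLimitOfReflects (forget F η p) (Abelian.isLimitMapConeOfKernelForkOfι _ _))⟩

noncomputable instance : Abelian (RootObj F η p) where

end Abelian

end RootObj

end Root

/-! ### The category `𝒜_η` -/

section Vanishing

variable {C : Type u} [Category.{v} C] [Abelian C]

/-- The property `η(M) = 0` of objects `M` of `𝒜`. -/
def vanishing {F : C ⥤ C} (η : F ⟶ 𝟭 C) : ObjectProperty C := fun M => η.app M = 0

/-- The full subcategory `𝒜_η` of `𝒜` of all objects `M` with `η(M) = 0`. -/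
abbrev VanishingCat {F : C ⥤ C} (η : F ⟶ 𝟭 C) := (vanishing η).FullSubcategory

variable {F : C ⥤ C} (η : F ⟶ 𝟭 C)

instance : (vanishing η).IsClosedUnderSubobjects where
  prop_of_mono {X Y} f _ hY := by
    change η.app X = 0
    have hY : η.app Y = 0 := hY
    have h := η.naturality f
    rw [hY, comp_zero] at h
    exact (cancel_mono f).1 (by simpa using h.symm)

instance [PreservesFiniteColimits F] : (vanishing η).IsClosedUnderQuotients where
  prop_of_epi {X Y} f _ hX := by
    change η.app Y = 0
    have hX : η.app X = 0 := hX
    have h := η.naturality f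
    rw [hX, zero_comp] at h
    exact (cancel_epi (F.map f)).1 (by simpa using h)

instance : (vanishing η).ContainsZero where
  exists_zero := by
    obtain ⟨Z, hZ⟩ := HasZeroObject.zero (C := C)
    exact ⟨Z, hZ, hZ.eq_of_tgt _ _⟩

instance : (vanishing η).IsClosedUnderFiniteProducts where
  isClosedUnderLimitsOfShape J _ := ⟨by
    rintro X ⟨c⟩
    refine c.isLimit.hom_ext fun j => ?_
    have hj : η.app (c.diag.obj j) = 0 := c.prop_diag_obj j
    have h := η.naturality (c.π.app j)
    rw [hj, comp_zero] at h
    simpa using h.symm⟩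

end Vanishing

/-! ### The case `F = 0` -/

section Zero

variable (D : Type u) [Category.{v} D] [Abelian D]

open ZeroObject in
/-- The zero endofunctor. -/
noncomputable def zeroFunctor : D ⥤ D := (Functor.const D).obj 0

lemma isZero_zeroFunctor : IsZero (zeroFunctor D) := Functor.isZero _ fun _ => isZero_zero D

instance : (zeroFunctor D).Additive where
  map_add := ((isZero_zeroFunctor D).obj _).eq_of_src _ _

instance : PreservesFiniteColimits (zeroFunctor D) :=
  ⟨fun _ _ _ => Functor.preservesColimitsOfShape_of_isZero _ (isZero_zeroFunctor D) _⟩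

/-- The zero natural transformation `0 ⟶ 𝟭`. -/
noncomputable def zeroTrans : zeroFunctor D ⟶ 𝟭 D where
  app _ := 0

end Zero

instance (p : ℕ) [p.AtLeastTwo] : NeZero (p - 1) :=
  ⟨by have := Nat.AtLeastTwo.prop (n := p); omega⟩

/-!
Write `𝒜` for the category `C`, `M₀ ⟶ ⋯ ⟶ M_{p-1}` for the sequence underlying an object of
`𝒜[η^{1/p}]`, and `pd` for projective dimensions.

*Objects.* For `0 ≤ k ≤ p` the object `stair k X` has `F X` at the positions `< k` and `X` at the
positions `≥ k`. For `k < p` the exact functor `stair k` is left adjoint to the exact functor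
`ev k : M ↦ M_k`, with invertible unit (`RootObj.stairAdjunction`); since both adjoints are exact,
`stair k` preserves `pd X < m` and reflects it. This gives `gldim 𝒜 ≤ gldim 𝒜[η^{1/p}]`. For `Y` in
`𝒜_η` the object `interval k l Y` has `Y` at the positions `k ≤ j < l`, and zero elsewhere. When
`η(X)` is mono there is a short exact sequence
`0 ⟶ stair (k+1) X ⟶ stair k X ⟶ interval k (k+1) (coker η(X)) ⟶ 0` (`RootObj.stair_shortExact`).

*Dévissage.* The kernel and cokernel of the canonical map `M ⟶ stair 0 M_{p-1}` vanish at the last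
position, so their morphism `f₁` is zero, and they are iterated extensions of objects
`interval k (k+1) Y`. Hence a common bound for `pd` on the `interval k (k+1) Y` which is at least
`gldim 𝒜` bounds `pd` everywhere (`RootObj.hasProjectiveDimensionLT_of_interval`).

*Upper bound.* Every `Y` in `𝒜_η` is a quotient of some `coker η(X)` with `η(X)` mono, for which
`pd (interval k (k+1) (coker η(X))) ≤ gldim 𝒜 + 1`. If `𝒜_η` has finite global dimension, dimension
shifting along such covers gives a crude finite bound for all the `interval k (k+1) Y`. It is then
improved step by step: as `F` is an equivalence, `Y ≅ F X` with `η(X) = 0`, and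
`interval k (k+1) Y` is a subobject of `stair (k+1) X`, so a bound `pd < m + 1` valid for all objects
implies `pd (interval k (k+1) Y) < m`, as long as `m` exceeds `gldim 𝒜`.

*Lower bound.* The class `θ` of `0 ⟶ interval 1 2 Y' ⟶ interval 0 2 Y' ⟶ interval 0 1 Y' ⟶ 0` yields
maps `Extⁿ(Y, Y') ⟶ Extⁿ⁺¹(interval 0 1 Y, interval 1 2 Y')`, and these are bijective: in degree
zero by a direct computation, in general since both sides are effaceable
(`CategoryTheory.Abelian.Ext.comp_bijective_of_effaceable`,
`RootObj.exists_epi_mk₀_comp_eq`). So `gldim 𝒜_η + 1 ≤ gldim 𝒜[η^{1/p}]`.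

*The case `F = 0`.* All `f₁` are zero and `η(Y) : 0 ⟶ Y` is always mono, so dévissage and the short
exact sequence above, with `coker η(Y) = Y`, give the bound `gldim ℬ + 1`.

Identities between morphisms of `𝒜[η^{1/p}]` are checked at each position `j`. Whether `j` lies in
the relevant range is recorded by booleans, and the identities are proved by cases on them.
-/

universe w w' w'' v' u'

set_option linter.unusedSectionVars false

/-! ### Dimension shifting and adjunctions for `Ext` -/

namespace CategoryTheory.Abelian

variable {C : Type u} [Category.{v} C] [Abelian C] [HasExt.{w} C]
  {D : Type u'} [Category.{v'} D] [Abelian D] [HasExt.{w'} D]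

omit [HasExt.{w} C] in
open HomologicalComplex in
/-- A complex in degrees `≤ i` resolving `X` placed in degree `i` maps onto `X` by its component of
degree `i`. -/
lemma exists_epi_single_comp {X : C} {K : CochainComplex C ℤ} {i : ℤ}
    (π : K ⟶ (single C (ComplexShape.up ℤ) i).obj X) [K.IsStrictlyLE i] [QuasiIsoAt π i] :
    ∃ (P : C) (q : P ⟶ X) (_ : Epi q) (s : (single C (ComplexShape.up ℤ) i).obj P ⟶ K),
      s ≫ π = (single C (ComplexShape.up ℤ) i).map q := by
  let e := K.iCyclesIso i (i + 1) (by simp)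
    ((K.isZero_of_isStrictlyLE i (i + 1) (by simp)).eq_of_tgt _ _)
  let α := e.inv ≫ K.homologyπ i ≫ homologyMap π i ≫ (singleObjHomologySelfIso _ _ _).hom
  have hα : π.f i = α ≫ (singleObjXSelf (ComplexShape.up ℤ) i X).inv := by
    rw [← cancel_epi e.hom]
    dsimp [α]
    rw [Category.assoc, Category.assoc, Category.assoc, Iso.hom_inv_id_assoc,
      homologyπ_naturality_assoc, homologyπ_singleObjHomologySelfIso_hom_assoc,
      ← singleObjCyclesSelfIso_inv_iCycles, Iso.hom_inv_id_assoc]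
    exact (cyclesMap_i π i).symm
  refine ⟨K.X i, α, inferInstance, mkHomFromSingle (𝟙 _) ?_, ?_⟩
  · intro j hj
    obtain rfl : i + 1 = j := hj
    apply (K.isZero_of_isStrictlyLE i (i + 1) (by simp)).eq_of_tgt
  · apply from_single_hom_ext
    rw [comp_f, mkHomFromSingle_f, Category.assoc, hα, single_map_f_self, Category.id_comp]

open _root_.DerivedCategory in
/-- `Ext` is effaceable in its first variable, in positive degrees. -/
lemma Ext.exists_epi_comp_eq_zero {X Y : C} {n : ℕ} (x : Ext X Y (n + 1)) :
    ∃ (P : C) (q : P ⟶ X) (_ : Epi q), (Ext.mk₀ q).comp x (zero_add _) = 0 := by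
  let := HasDerivedCategory.standard C
  let φ : Q.obj ((CochainComplex.singleFunctor C 0).obj X) ⟶
      Q.obj ((CochainComplex.singleFunctor C (-(n + 1))).obj Y) :=
    x.hom ≫ ((singleFunctors C).shiftIso (n + 1) (-(n + 1)) 0 (by lia)).hom.app _
  obtain ⟨K, _, π, h, g, hφ⟩ := right_fac_of_isStrictlyLE φ 0
  rw [isIso_Q_map_iff_quasiIso] at h
  let π' : K ⟶ (HomologicalComplex.single C (ComplexShape.up ℤ) 0).obj X := π
  have h' : QuasiIsoAt π' 0 := h.quasiIsoAt 0
  obtain ⟨P, q, hq, s', hs'⟩ := exists_epi_single_comp π'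
  let s : (CochainComplex.singleFunctor C 0).obj P ⟶ K := s'
  have hs : s ≫ π = (CochainComplex.singleFunctor C 0).map q := hs'
  refine ⟨P, q, hq, ?_⟩
  apply Ext.homEquiv.injective
  simp only [← cancel_mono (((singleFunctors C).shiftIso (n + 1) (-(n + 1)) 0
    (by lia)).hom.app _), Ext.zero_hom, Limits.zero_comp]
  have h₀ : s ≫ g = 0 := by
    apply HomologicalComplex.from_single_hom_ext
    apply (CochainComplex.isZero_of_isStrictlyLE _ (-(n+1)) 0 (by lia)).eq_of_tgt
  have h₁ : Q.map ((CochainComplex.singleFunctor C 0).map q) ≫ φ = 0 := by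
    rw [hφ, ← hs, Functor.map_comp, Category.assoc]
    have : IsIso (Q.map π) := by rwa [isIso_Q_map_iff_quasiIso]
    rw [IsIso.hom_inv_id_assoc, ← Functor.map_comp, h₀, Functor.map_zero]
  refine Eq.trans ?_ h₁
  exact (congrArg (· ≫ _) (Ext.singleFunctor_map_comp_hom q x).symm).trans (Category.assoc _ _ _)

/-- Dimension shifting without projectives: every class of positive degree is the Yoneda product of the
class of a short exact sequence and a class of one degree less. -/
lemma Ext.exists_shortExact_extClass_comp {X Y : C} {n : ℕ} (x : Ext X Y (n + 1)) :
    ∃ (K P : C) (i : K ⟶ P) (q : P ⟶ X) (w : i ≫ q = 0)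
      (hS : (ShortComplex.mk i q w).ShortExact) (y : Ext K Y n),
      x = hS.extClass.comp y (add_comm 1 n) := by
  obtain ⟨P, q, hq, hx⟩ := Ext.exists_epi_comp_eq_zero x
  have hS : (ShortComplex.mk (kernel.ι q) q (kernel.condition q)).ShortExact :=
    { exact := ShortComplex.exact_kernel q }
  obtain ⟨y, hy⟩ := Ext.contravariant_sequence_exact₃ hS Y x hx (add_comm 1 n)
  exact ⟨_, _, _, _, _, hS, y, hy.symm⟩

section Adjunction

variable (L : C ⥤ D) (R : D ⥤ C) [L.Additive] [R.Additive] [PreservesFiniteLimits L]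
  [PreservesFiniteLimits R] [PreservesFiniteColimits L] [PreservesFiniteColimits R]

lemma Ext.mapExactFunctor_mapExactFunctor_extClass_comp {S : ShortComplex D} (hS : S.ShortExact)
    {Y : D} {n m : ℕ} (y : Ext S.X₁ Y n) (h : 1 + n = m) :
    ((hS.extClass.comp y h).mapExactFunctor R).mapExactFunctor L =
      ((hS.map_of_exact R).map_of_exact L).extClass.comp
        ((y.mapExactFunctor R).mapExactFunctor L) h := by
  rw [Ext.mapExactFunctor_comp, Ext.mapExactFunctor_comp]
  refine congrArg (fun t => Ext.comp t _ h) ?_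
  exact (congrArg (Ext.mapExactFunctor L) (Ext.mapExactFunctor_extClass R hS)).trans
    (Ext.mapExactFunctor_extClass L (hS.map_of_exact R))

/-- Natural transformations of exact functors are natural with respect to classes of all degrees. -/
lemma Ext.mapExactFunctor_comp_counit (ε : R ⋙ L ⟶ 𝟭 D) {X Y : D} {n : ℕ} (x : Ext X Y n) :
    ((x.mapExactFunctor R).mapExactFunctor L).comp (Ext.mk₀ (ε.app Y)) (add_zero n) =
      (Ext.mk₀ (ε.app X)).comp x (zero_add n) := by
  induction n generalizing X with
  | zero =>
    obtain ⟨f, rfl⟩ := (Ext.mk₀_bijective X Y).2 x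
    rw [Ext.mapExactFunctor_mk₀, Ext.mapExactFunctor_mk₀, Ext.mk₀_comp_mk₀]
    refine Eq.trans ?_ (Ext.mk₀_comp_mk₀ (ε.app X) f).symm
    exact congrArg Ext.mk₀ (ε.naturality f)
  | succ n ih =>
    obtain ⟨K, P, i, q, w, hS, y, rfl⟩ := Ext.exists_shortExact_extClass_comp x
    rw [Ext.mapExactFunctor_mapExactFunctor_extClass_comp L R hS y]
    have h := ShortComplex.ShortExact.extClass_naturality ((hS.map_of_exact R).map_of_exact L) hS
      { τ₁ := ε.app K, τ₂ := ε.app P, τ₃ := ε.app X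
        comm₁₂ := (ε.naturality i).symm, comm₂₃ := (ε.naturality q).symm }
    have h' := congrArg (fun t => t.comp y (add_comm 1 n)) h
    dsimp only at h'
    rw [Ext.comp_assoc_of_second_deg_zero] at h'
    refine (Ext.comp_assoc_of_third_deg_zero _ _ _ _).trans ?_
    refine (congrArg (fun t => Ext.comp _ t _) (ih y)).trans (h'.trans ?_)
    exact Ext.comp_assoc _ _ _ _ _ (by lia)

lemma Ext.comp_unit_eq (η : 𝟭 C ⟶ L ⋙ R) {X Y : C} {n : ℕ} (x : Ext X Y n) :
    x.comp (Ext.mk₀ (η.app Y)) (add_zero n) =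
      (Ext.mk₀ (η.app X)).comp ((x.mapExactFunctor L).mapExactFunctor R) (zero_add n) := by
  induction n generalizing X with
  | zero =>
    obtain ⟨f, rfl⟩ := (Ext.mk₀_bijective X Y).2 x
    rw [Ext.mapExactFunctor_mk₀, Ext.mapExactFunctor_mk₀]
    exact (Ext.mk₀_comp_mk₀ f (η.app Y)).trans ((congrArg Ext.mk₀ (η.naturality f)).trans
      (Ext.mk₀_comp_mk₀ (η.app X) (R.map (L.map f))).symm)
  | succ n ih =>
    obtain ⟨K, P, i, q, w, hS, y, rfl⟩ := Ext.exists_shortExact_extClass_comp x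
    rw [Ext.mapExactFunctor_mapExactFunctor_extClass_comp R L hS y,
      Ext.comp_assoc_of_third_deg_zero, ih]
    have h := ShortComplex.ShortExact.extClass_naturality hS ((hS.map_of_exact L).map_of_exact R)
      { τ₁ := η.app K, τ₂ := η.app P, τ₃ := η.app X
        comm₁₂ := (η.naturality i).symm, comm₂₃ := (η.naturality q).symm }
    have h' := congrArg (fun t => t.comp ((y.mapExactFunctor L).mapExactFunctor R)
      (add_comm 1 n)) h
    dsimp only at h'
    refine Eq.trans ?_ (h'.trans ?_)
    · exact (Ext.comp_assoc_of_second_deg_zero _ _ _ _).symm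
    · exact Ext.comp_assoc _ _ _ _ _ (by lia)

variable {L R}

/-- The adjunction isomorphism on `Ext`: a class on `L X` is determined by its image under `R`,
restricted along the unit. -/
lemma Ext.eq_mapExactFunctor_unit_comp_counit (adj : L ⊣ R) {X : C} {N : D} {n : ℕ}
    (x : Ext (L.obj X) N n) :
    x = (((Ext.mk₀ (adj.unit.app X)).comp (x.mapExactFunctor R) (zero_add n)).mapExactFunctor
      L).comp (Ext.mk₀ (adj.counit.app N)) (add_zero n) := by
  rw [Ext.mapExactFunctor_comp, Ext.comp_assoc_of_third_deg_zero,
    Ext.mapExactFunctor_comp_counit, Ext.mapExactFunctor_mk₀]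
  refine Eq.symm ((Ext.mk₀_comp_mk₀_assoc (L.map (adj.unit.app X)) (adj.counit.app (L.obj X))
    x).trans ?_)
  exact (congrArg (fun t => (Ext.mk₀ t).comp x (zero_add n))
    (adj.left_triangle_components X)).trans (Ext.mk₀_id_comp x)

lemma hasProjectiveDimensionLT_obj_of_adjunction (adj : L ⊣ R) (X : C) (m : ℕ)
    [HasProjectiveDimensionLT X m] : HasProjectiveDimensionLT (L.obj X) m := by
  refine HasProjectiveDimensionLT.mk fun i hi N x => ?_
  have h : (Ext.mk₀ (adj.unit.app X)).comp (x.mapExactFunctor R) (zero_add i) = 0 :=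
    Ext.eq_zero_of_hasProjectiveDimensionLT (X := X) _ m hi
  rw [Ext.eq_mapExactFunctor_unit_comp_counit adj x, h, Ext.mapExactFunctor_zero, Ext.zero_comp]

lemma hasProjectiveDimensionLT_of_obj_of_adjunction (adj : L ⊣ R) [IsIso adj.unit]
    (X : C) (m : ℕ) [HasProjectiveDimensionLT (L.obj X) m] : HasProjectiveDimensionLT X m := by
  refine HasProjectiveDimensionLT.mk fun i hi Y x => ?_
  have h := Ext.comp_unit_eq L R adj.unit x
  rw [Ext.eq_zero_of_hasProjectiveDimensionLT (x.mapExactFunctor L) m hi,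
    Ext.mapExactFunctor_zero, Ext.comp_zero] at h
  have h' := congrArg (fun t => t.comp (Ext.mk₀ (inv (adj.unit.app Y))) (add_zero i)) h
  rw [Ext.comp_assoc_of_third_deg_zero, Ext.zero_comp] at h'
  have e := Ext.mk₀_comp_mk₀ (adj.unit.app Y) (inv (adj.unit.app Y))
  rw [IsIso.hom_inv_id] at e
  exact (Ext.comp_mk₀_id x).symm.trans ((congrArg (fun t => x.comp t (add_zero i)) e).symm.trans h')

end Adjunction

/-- If all objects `Y` satisfy `pd Y < b`, and each of them is covered by some `Z` with
`pd (S Z) ≤ c`, then `pd (S Y) < b + c + 1`: by dimension shifting along the covers, a class of degree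
`b + m` on `S Y` with `m > c` is divisible by the image under `S` of a class of degree `b`. -/
lemma hasProjectiveDimensionLT_obj_of_epi_cover (S : C ⥤ D) [S.Additive]
    [PreservesFiniteLimits S] [PreservesFiniteColimits S] (b c : ℕ)
    (hb : ∀ Y : C, HasProjectiveDimensionLT Y b)
    (hc : ∀ Y : C, ∃ (Z : C) (q : Z ⟶ Y), Epi q ∧ HasProjectiveDimensionLT (S.obj Z) (c + 1))
    (Y : C) : HasProjectiveDimensionLT (S.obj Y) (b + (c + 1)) := by
  -- Every class of degree `k + m` is divisible by the image of a class of degree `k`.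
  have key : ∀ (k n m : ℕ) (_ : c + 1 ≤ m) (h : k + m = n) (W : D) (x : Ext (S.obj Y) W n),
      ∃ (Y' : C) (e : Ext Y Y' k) (z : Ext (S.obj Y') W m),
        x = (e.mapExactFunctor S).comp z h := by
    intro k
    induction k with
    | zero =>
      intro n m hm h W x
      obtain rfl : m = n := by lia
      refine ⟨Y, Ext.mk₀ (𝟙 Y), x, ?_⟩
      rw [Ext.mapExactFunctor_mk₀, S.map_id, Ext.mk₀_id_comp]
    | succ k ih =>
      intro n m hm h W x
      obtain ⟨Y', e, z, rfl⟩ := ih n (m + 1) (by lia) (by lia) W x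
      obtain ⟨Z, q, hq, hZ⟩ := hc Y'
      have hS : (ShortComplex.mk (kernel.ι q) q (kernel.condition q)).ShortExact :=
        { exact := ShortComplex.exact_kernel q }
      obtain ⟨y, hy⟩ := Ext.contravariant_sequence_exact₃ (hS.map_of_exact S) W z
        (Ext.eq_zero_of_hasProjectiveDimensionLT (X := S.obj Z) _ (c + 1) (by lia)) (add_comm 1 m)
      refine ⟨_, e.comp hS.extClass rfl, y, ?_⟩
      rw [← hy, Ext.mapExactFunctor_comp, ← Ext.mapExactFunctor_extClass]
      exact (Ext.comp_assoc _ _ _ _ _ (by lia)).symm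
  refine HasProjectiveDimensionLT.mk fun i hi W x => ?_
  obtain ⟨m, rfl⟩ := Nat.exists_eq_add_of_le (show b ≤ i by lia)
  obtain ⟨Y', e, z, rfl⟩ := key b (b + m) m (by lia) rfl W x
  rw [Ext.eq_zero_of_hasProjectiveDimensionLT e b le_rfl, Ext.mapExactFunctor_zero, Ext.zero_comp]

lemma Ext.comp_sub {X Y Z : C} {n m p : ℕ} (α : Ext X Y n) (β₁ β₂ : Ext Y Z m) (h : n + m = p) :
    α.comp (β₁ - β₂) h = α.comp β₁ h - α.comp β₂ h :=
  map_sub (α.precomp Z h) β₁ β₂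

lemma Ext.sub_comp {X Y Z : C} {n m p : ℕ} (α₁ α₂ : Ext X Y n) (β : Ext Y Z m) (h : n + m = p) :
    (α₁ - α₂).comp β h = α₁.comp β h - α₂.comp β h :=
  map_sub (β.postcomp X h) α₁ α₂

/-- The maps `Extⁿ(Y, Y') ⟶ Extⁿ⁺¹(S Y, W)`, `x ↦ S x · θ`, for a class `θ` of degree one are
bijective for all `n`, provided that there are no nonzero morphisms `S Y ⟶ W`, that the map is
injective for `n = 0`, and that every class on the right lifts to the left after restriction along an
epimorphism onto `Y`. These maps commute with the connecting maps of the long exact sequences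
in `Y`, so an induction on `n` and diagram chases suffice. -/
lemma Ext.comp_bijective_of_effaceable (S : C ⥤ D) [S.Additive]
    [PreservesFiniteLimits S] [PreservesFiniteColimits S] {Y' : C} {W : D}
    (θ : Ext (S.obj Y') W 1)
    (h₀ : ∀ (Y : C) (f : S.obj Y ⟶ W), f = 0)
    (h₁ : ∀ (Y : C) (f : Y ⟶ Y'), (Ext.mk₀ (S.map f)).comp θ (zero_add 1) = 0 → f = 0)
    (h₂ : ∀ (n : ℕ) (Y : C) (v : Ext (S.obj Y) W (n + 1)), ∃ (Z : C) (q : Z ⟶ Y) (g : Ext Z Y' n),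
      Epi q ∧ (Ext.mk₀ (S.map q)).comp v (zero_add _) = (g.mapExactFunctor S).comp θ rfl)
    (n : ℕ) :
    (∀ (Y : C) (x : Ext Y Y' n), (x.mapExactFunctor S).comp θ rfl = 0 → x = 0) ∧
      ∀ (Y : C) (v : Ext (S.obj Y) W (n + 1)), ∃ x : Ext Y Y' n,
        (x.mapExactFunctor S).comp θ rfl = v := by
  -- Injectivity in degree `n` reduces surjectivity to classes coming from connecting maps.
  have surj : ∀ n : ℕ, (∀ (Y : C) (x : Ext Y Y' n), (x.mapExactFunctor S).comp θ rfl = 0 → x = 0) →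
      (∀ (K P Y : C) (i : K ⟶ P) (q : P ⟶ Y) (w : i ≫ q = 0)
        (hS : (ShortComplex.mk i q w).ShortExact) (u : Ext (S.obj K) W n), ∃ x : Ext Y Y' n,
          (hS.map_of_exact S).extClass.comp u (add_comm 1 n) =
            (x.mapExactFunctor S).comp θ rfl) →
      ∀ (Y : C) (v : Ext (S.obj Y) W (n + 1)), ∃ x : Ext Y Y' n,
        (x.mapExactFunctor S).comp θ rfl = v := by
    intro n inj hδ Y v
    obtain ⟨Z, q, g, hq, hg⟩ := h₂ n Y v
    have hS : (ShortComplex.mk (kernel.ι q) q (kernel.condition q)).ShortExact :=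
      { exact := ShortComplex.exact_kernel q }
    have h : (Ext.mk₀ (kernel.ι q)).comp g (zero_add n) = 0 := by
      apply inj
      rw [Ext.mapExactFunctor_comp, Ext.comp_assoc _ _ _ _ (rfl : n + 1 = n + 1) (by lia), ← hg,
        Ext.mapExactFunctor_mk₀, Ext.mk₀_comp_mk₀_assoc, ← S.map_comp, kernel.condition,
        S.map_zero, Ext.mk₀_zero, Ext.zero_comp]
    obtain ⟨x, rfl⟩ := Ext.contravariant_sequence_exact₂ hS Y' g h
    have h' : (Ext.mk₀ (S.map q)).comp (v - (x.mapExactFunctor S).comp θ rfl) (zero_add _) = 0 := by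
      rw [Ext.comp_sub, hg, Ext.mapExactFunctor_comp,
        Ext.comp_assoc _ _ _ _ (rfl : n + 1 = n + 1) (by lia), Ext.mapExactFunctor_mk₀, sub_self]
    obtain ⟨u, hu⟩ := Ext.contravariant_sequence_exact₃ (hS.map_of_exact S) W _ h' (add_comm 1 n)
    obtain ⟨x', hx'⟩ := hδ _ _ _ _ _ _ hS u
    refine ⟨x + x', ?_⟩
    rw [Ext.mapExactFunctor_add, Ext.add_comp, ← hx']
    exact (congrArg _ hu).trans (add_sub_cancel _ _)
  induction n with
  | zero =>
    have inj : ∀ (Y : C) (x : Ext Y Y' 0), (x.mapExactFunctor S).comp θ rfl = 0 → x = 0 := by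
      intro Y x hx
      obtain ⟨f, rfl⟩ := (Ext.mk₀_bijective Y Y').2 x
      rw [Ext.mapExactFunctor_mk₀] at hx
      rw [h₁ Y f hx, Ext.mk₀_zero]
    refine ⟨inj, surj 0 inj ?_⟩
    intro K P Y i q w hS u
    obtain ⟨f, rfl⟩ := (Ext.mk₀_bijective _ _).2 u
    refine ⟨0, ?_⟩
    rw [h₀ K f, Ext.mk₀_zero, Ext.mapExactFunctor_zero, Ext.zero_comp]
    exact Ext.comp_zero _ _ _ _ _
  | succ n ih =>
    have inj : ∀ (Y : C) (x : Ext Y Y' (n + 1)), (x.mapExactFunctor S).comp θ rfl = 0 → x = 0 := by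
      intro Y x hx
      obtain ⟨K, P, i, q, w, hS, y, rfl⟩ := Ext.exists_shortExact_extClass_comp x
      have e : (hS.map_of_exact S).extClass.comp ((y.mapExactFunctor S).comp θ rfl)
          (add_comm 1 (n + 1)) = 0 := by
        rw [Ext.mapExactFunctor_comp, Ext.mapExactFunctor_extClass] at hx
        exact (Ext.comp_assoc _ _ _ _ _ (by lia)).symm.trans hx
      obtain ⟨z, hz⟩ := Ext.contravariant_sequence_exact₁ (hS.map_of_exact S) W _ _ e
      obtain ⟨z', rfl⟩ := ih.2 P z
      have h' : y = (Ext.mk₀ i).comp z' (zero_add n) := by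
        refine sub_eq_zero.1 (ih.1 _ _ ?_)
        rw [← Functor.mapExtAddHom_apply, map_sub, Functor.mapExtAddHom_apply,
          Functor.mapExtAddHom_apply, Ext.sub_comp, ← hz, Ext.mapExactFunctor_comp,
          Ext.mapExactFunctor_mk₀]
        refine sub_eq_zero.2 (Ext.comp_assoc _ _ _ _ _ (by lia)).symm
      rw [h']
      exact hS.extClass_comp_assoc z'
    refine ⟨inj, surj (n + 1) inj ?_⟩
    intro K P Y i q w hS u
    obtain ⟨x, rfl⟩ := ih.2 K u
    refine ⟨hS.extClass.comp x (add_comm 1 n), ?_⟩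
    rw [Ext.mapExactFunctor_comp, Ext.mapExactFunctor_extClass]
    exact (Ext.comp_assoc _ _ _ _ _ (by lia)).symm

end CategoryTheory.Abelian

/-! ### Exactness in `𝒜[η^{1/p}]` is checked componentwise -/

namespace RootObj

section Evaluation

variable {C : Type u} [Category.{v} C] {F : C ⥤ C} {η : F ⟶ 𝟭 C} {p : ℕ} [NeZero p]

variable (F η) in
/-- The functor `M ↦ M_j`. -/
abbrev ev (j : Fin p) : RootObj F η p ⥤ C := forget F η p ⋙ (evaluation (Fin p) C).obj j

variable [Abelian C] [F.Additive] [PreservesFiniteColimits F]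

lemma isZero_of_ev {M : RootObj F η p} (h : ∀ j, IsZero (M.seq.obj j)) : IsZero M := by
  rw [IsZero.iff_id_eq_zero]
  ext j
  exact (h j).eq_of_src _ _

lemma mono_of_ev {M N : RootObj F η p} (f : M ⟶ N) (h : ∀ j, Mono (f.seq.app j)) : Mono f :=
  (forget F η p).mono_of_mono_map ((NatTrans.mono_iff_mono_app f.seq).2 h)

lemma epi_of_ev {M N : RootObj F η p} (f : M ⟶ N) (h : ∀ j, Epi (f.seq.app j)) : Epi f :=
  (forget F η p).epi_of_epi_map ((NatTrans.epi_iff_epi_app f.seq).2 h)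

lemma isIso_of_ev {M N : RootObj F η p} (f : M ⟶ N) (h : ∀ j, IsIso (f.seq.app j)) : IsIso f := by
  have : IsIso ((forget F η p).map f) := (NatTrans.isIso_iff_isIso_app f.seq).2 h
  exact isIso_of_reflects_iso f (forget F η p)

instance mono_app {M N : RootObj F η p} (f : M ⟶ N) [Mono f] (j : Fin p) : Mono (f.seq.app j) :=
  inferInstanceAs (Mono ((ev F η j).map f))

instance epi_app {M N : RootObj F η p} (f : M ⟶ N) [Epi f] (j : Fin p) : Epi (f.seq.app j) :=
  inferInstanceAs (Epi ((ev F η j).map f))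

lemma shortExact_of_ev {S : ShortComplex (RootObj F η p)}
    (h : ∀ j, (S.map (ev F η j)).ShortExact) : S.ShortExact where
  exact := by
    rw [ShortComplex.exact_iff_isZero_homology]
    refine isZero_of_ev fun j => ?_
    have := (ShortComplex.exact_iff_isZero_homology _).1 (h j).exact
    exact this.of_iso (S.mapHomologyIso (ev F η j)).symm
  mono_f := mono_of_ev _ fun j => (h j).mono_f
  epi_g := epi_of_ev _ fun j => (h j).epi_g

variable {E : Type u'} [Category.{v'} E]

lemma preservesFiniteLimits_of_ev (Φ : E ⥤ RootObj F η p)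
    (h : ∀ j, PreservesFiniteLimits (Φ ⋙ ev F η j)) : PreservesFiniteLimits Φ :=
  ⟨fun J _ _ => by
    have : PreservesLimitsOfShape J (Φ ⋙ forget F η p) :=
      preservesLimitsOfShape_of_evaluation _ _ fun j =>
        inferInstanceAs (PreservesLimitsOfShape J (Φ ⋙ ev F η j))
    exact preservesLimitsOfShape_of_reflects_of_preserves Φ (forget F η p)⟩

lemma preservesFiniteColimits_of_ev (Φ : E ⥤ RootObj F η p)
    (h : ∀ j, PreservesFiniteColimits (Φ ⋙ ev F η j)) : PreservesFiniteColimits Φ :=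
  ⟨fun J _ _ => by
    have : PreservesColimitsOfShape J (Φ ⋙ forget F η p) :=
      preservesColimitsOfShape_of_evaluation _ _ fun j =>
        inferInstanceAs (PreservesColimitsOfShape J (Φ ⋙ ev F η j))
    exact preservesColimitsOfShape_of_reflects_of_preserves Φ (forget F η p)⟩

lemma additive_of_ev [Preadditive E] (Φ : E ⥤ RootObj F η p) (h : ∀ j, (Φ ⋙ ev F η j).Additive) :
    Φ.Additive where
  map_add {X Y f g} := by
    ext j
    exact (Φ ⋙ ev F η j).map_add

end Evaluation

/-! ### The objects `stair k X` -/

section Stair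

variable {C : Type u} [Category.{v} C]

/-- The identity functor for `true`, and `F` for `false`. -/
def twist (F : C ⥤ C) : Bool → (C ⥤ C)
  | true => 𝟭 C
  | false => F

variable {F : C ⥤ C} (η : F ⟶ 𝟭 C)

/-- The transition morphisms `F X ⟶ X` between the values of `twist F`. -/
def twistMap (X : C) : ∀ a b : Bool, a ≤ b → ((twist F a).obj X ⟶ (twist F b).obj X)
  | true, true, _ => 𝟙 _
  | false, false, _ => 𝟙 _
  | false, true, _ => η.app X
  | true, false, h => absurd h (by decide)

/-- The morphism `F M_⊤ ⟶ M_⊥` for an object with `M_⊤ = twist F a X` and `M_⊥ = twist F b X`. The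
case `a = false`, `b = true` does not occur for `stair k X`; its value is chosen so that
`map_twistMap_twistConn` holds in all cases. -/
def twistConn (X : C) : ∀ a b : Bool, F.obj ((twist F a).obj X) ⟶ (twist F b).obj X
  | true, true => η.app X
  | true, false => 𝟙 (F.obj X)
  | false, true => η.app (F.obj X) ≫ η.app X
  | false, false => η.app (F.obj X)

lemma twistMap_self (X : C) (a : Bool) : twistMap η X a a le_rfl = 𝟙 _ := by
  cases a <;> rfl

lemma twistMap_comp (X : C) (a b c : Bool) (h : a ≤ b) (h' : b ≤ c) :
    twistMap η X a b h ≫ twistMap η X b c h' = twistMap η X a c (h.trans h') := by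
  cases a <;> cases b <;> cases c <;>
    first | exact Category.id_comp _ | exact Category.comp_id _ | exact absurd h (by decide) |
      exact absurd h' (by decide)

lemma twistMap_naturality {X Y : C} (f : X ⟶ Y) (a b : Bool) (h : a ≤ b) :
    twistMap η X a b h ≫ (twist F b).map f = (twist F a).map f ≫ twistMap η Y a b h := by
  cases a <;> cases b
  · exact (Category.id_comp _).trans (Category.comp_id _).symm
  · exact (η.naturality f).symm
  · exact absurd h (by decide)
  · exact (Category.id_comp _).trans (Category.comp_id _).symm

lemma twistConn_naturality {X Y : C} (f : X ⟶ Y) (a b : Bool) :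
    F.map ((twist F a).map f) ≫ twistConn η Y a b = twistConn η X a b ≫ (twist F b).map f := by
  cases a <;> cases b
  · exact η.naturality (F.map f)
  · have h₁ : F.map (F.map f) ≫ η.app (F.obj Y) = η.app (F.obj X) ≫ F.map f :=
      η.naturality (F.map f)
    have h₂ : F.map f ≫ η.app Y = η.app X ≫ f := η.naturality f
    change F.map (F.map f) ≫ η.app (F.obj Y) ≫ η.app Y = (η.app (F.obj X) ≫ η.app X) ≫ f
    rw [reassoc_of% h₁, h₂, Category.assoc]
  · exact (Category.comp_id _).trans (Category.id_comp _).symm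
  · exact η.naturality f

variable {η} (hη : ∀ X, F.map (η.app X) = η.app (F.obj X))

include hη in
lemma twistMap_cycle (X : C) (a b c : Bool) (h : b ≤ c) (h' : c ≤ a) :
    F.map (twistMap η X c a h') ≫ twistConn η X a b ≫ twistMap η X b c h =
      η.app ((twist F c).obj X) := by
  cases c <;> cases a <;> cases b
  · change F.map (𝟙 (F.obj X)) ≫ η.app (F.obj X) ≫ 𝟙 (F.obj X) = η.app (F.obj X)
    simp
  · exact absurd h (by decide)
  · change F.map (η.app X) ≫ 𝟙 (F.obj X) ≫ 𝟙 (F.obj X) = η.app (F.obj X)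
    simp [hη]
  · exact absurd h (by decide)
  · exact absurd h' (by decide)
  · exact absurd h' (by decide)
  · change F.map (𝟙 X) ≫ 𝟙 (F.obj X) ≫ η.app X = η.app X
    simp
  · change F.map (𝟙 X) ≫ η.app X ≫ 𝟙 X = η.app X
    simp

include hη in
lemma map_twistMap_twistConn (X : C) (a b a' b' : Bool) (h : a' ≤ a) (h' : b' ≤ b) :
    F.map (twistMap η X a' a h) ≫ twistConn η X a b =
      twistConn η X a' b' ≫ twistMap η X b' b h' := by
  cases a' <;> cases a <;> cases b' <;> cases b <;> first
    | exact absurd h (by decide)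
    | exact absurd h' (by decide)
    | skip
  · change F.map (𝟙 (F.obj X)) ≫ η.app (F.obj X) = η.app (F.obj X) ≫ 𝟙 (F.obj X)
    simp
  · change F.map (𝟙 (F.obj X)) ≫ η.app (F.obj X) ≫ η.app X = η.app (F.obj X) ≫ η.app X
    simp
  · change F.map (𝟙 (F.obj X)) ≫ η.app (F.obj X) ≫ η.app X =
      (η.app (F.obj X) ≫ η.app X) ≫ 𝟙 X
    simp
  · change F.map (η.app X) ≫ 𝟙 (F.obj X) = η.app (F.obj X) ≫ 𝟙 (F.obj X)
    rw [hη]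
  · change F.map (η.app X) ≫ η.app X = η.app (F.obj X) ≫ η.app X
    rw [hη]
  · change F.map (η.app X) ≫ η.app X = (η.app (F.obj X) ≫ η.app X) ≫ 𝟙 X
    rw [hη]
    exact (Category.comp_id _).symm
  · change F.map (𝟙 X) ≫ 𝟙 (F.obj X) = 𝟙 (F.obj X) ≫ 𝟙 (F.obj X)
    simp
  · change F.map (𝟙 X) ≫ η.app X = 𝟙 (F.obj X) ≫ η.app X
    simp
  · change F.map (𝟙 X) ≫ η.app X = η.app X ≫ 𝟙 X
    simp

variable {p : ℕ} [NeZero p]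

/-- Whether the position `j` is at least `k`. -/
def step (k : ℕ) (j : Fin p) : Bool := decide (k ≤ j)

omit [NeZero p] in
lemma step_mono (k : ℕ) {i j : Fin p} (h : i ≤ j) : step k i ≤ step k j :=
  Bool.le_iff_imp.2 fun hi => decide_eq_true ((of_decide_eq_true hi).trans h)

omit [NeZero p] in
lemma step_anti {k l : ℕ} (h : k ≤ l) (j : Fin p) : step l j ≤ step k j :=
  Bool.le_iff_imp.2 fun hi => decide_eq_true (h.trans (of_decide_eq_true hi))

/-- The functor `X ↦ (F X = ⋯ = F X ⟶ X = ⋯ = X)`, with `F X` at the positions `j < k`. For `k = 0` it is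
the constant sequence `X` with `f₁ = η(X)`; for `k = p` it is the constant sequence `F X`. -/
noncomputable def stair (k : ℕ) : C ⥤ RootObj F η p where
  obj X :=
    { seq :=
        { obj j := (twist F (step k j)).obj X
          map f := twistMap η X _ _ (step_mono k f.le)
          map_id _ := twistMap_self η X _
          map_comp _ _ := (twistMap_comp η X _ _ _ _ _).symm }
      conn := twistConn η X _ _
      cycle _ := twistMap_cycle hη X _ _ _ _ _ }
  map f :=
    { seq :=
        { app j := (twist F (step k j)).map f
          naturality _ _ _ := twistMap_naturality η f _ _ _ }
      comm := twistConn_naturality η f _ _ }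
  map_id X := by ext; exact (twist F _).map_id X
  map_comp f g := by ext; exact (twist F _).map_comp f g

/-- The morphism `stair l ⟶ stair k` for `k ≤ l`, equal to `η(X) : F X ⟶ X` at the positions
`k ≤ j < l` and to the identity elsewhere. -/
noncomputable def stairMap {k l : ℕ} (h : k ≤ l) : stair (p := p) hη l ⟶ stair hη k where
  app X :=
    { seq :=
        { app j := twistMap η X _ _ (step_anti h j)
          naturality _ _ _ := (twistMap_comp η X _ _ _ _ _).trans
            (twistMap_comp η X _ _ _ _ _).symm }
      comm := map_twistMap_twistConn hη X _ _ _ _ _ _ }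
  naturality _ _ f := by ext; exact (twistMap_naturality η f _ _ _).symm

end Stair

/-! ### The adjunction between `stair i` and evaluation at `i` -/

section StairAdjunction

variable {C : Type u} [Category.{v} C] [Abelian C] {F : C ⥤ C} [F.Additive]
  [PreservesFiniteLimits F] [PreservesFiniteColimits F]
  {η : F ⟶ 𝟭 C} (hη : ∀ X, F.map (η.app X) = η.app (F.obj X)) {p : ℕ} [NeZero p]

omit [NeZero p] in
lemma step_eq_true_iff {k : ℕ} {j : Fin p} : step k j = true ↔ k ≤ j := decide_eq_true_iff

omit [NeZero p] in
lemma step_eq_false_iff {k : ℕ} {j : Fin p} : step k j = false ↔ (j : ℕ) < k := by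
  rw [step, decide_eq_false_iff_not, not_le]

instance (b : Bool) : PreservesFiniteLimits (twist F b) := by
  cases b
  · exact inferInstanceAs (PreservesFiniteLimits F)
  · exact inferInstanceAs (PreservesFiniteLimits (𝟭 C))

instance (b : Bool) : PreservesFiniteColimits (twist F b) := by
  cases b
  · exact inferInstanceAs (PreservesFiniteColimits F)
  · exact inferInstanceAs (PreservesFiniteColimits (𝟭 C))

instance (b : Bool) : (twist F b).Additive := by
  cases b
  · exact inferInstanceAs F.Additive
  · exact inferInstanceAs (𝟭 C).Additive

instance (k : ℕ) : PreservesFiniteLimits (stair (p := p) hη k) :=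
  preservesFiniteLimits_of_ev (F := F) (η := η) _ fun j =>
    inferInstanceAs (PreservesFiniteLimits (twist F (step k j)))

instance (k : ℕ) : PreservesFiniteColimits (stair (p := p) hη k) :=
  preservesFiniteColimits_of_ev _ fun j =>
    inferInstanceAs (PreservesFiniteColimits (twist F (step k j)))

instance (k : ℕ) : (stair (p := p) hη k).Additive :=
  additive_of_ev (F := F) (η := η) _ fun j => inferInstanceAs ((twist F (step k j)).Additive)

/-- The unit of `stairAdjunction`; only the value at `true` is used. -/
def twistUnit (F : C ⥤ C) (X : C) : ∀ b : Bool, X ⟶ (twist F b).obj X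
  | true => 𝟙 X
  | false => 0

open Classical in
/-- The component at `j` of the counit of `stairAdjunction` at `N`: the transition morphism
`N_i ⟶ N_j` where `stair i N_i` has the value `N_i` (that is, for `i ≤ j`), and the composition
`F N_i ⟶ F N_⊤ ⟶ N_⊥ ⟶ N_j` where it has the value `F N_i`. -/
noncomputable def stairCounitApp (N : RootObj F η p) (i j : Fin p) :
    ∀ b : Bool, (twist F b).obj (N.seq.obj i) ⟶ N.seq.obj j
  | true => if h : i ≤ j then N.seq.map (homOfLE h) else 0
  | false => F.map (N.seq.map (homOfLE le_top)) ≫ N.conn ≫ N.seq.map (homOfLE bot_le)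

lemma stairCounitApp_true (N : RootObj F η p) {i j : Fin p} (h : i ≤ j) :
    stairCounitApp N i j true = N.seq.map (homOfLE h) := dif_pos h

lemma twistMap_stairCounitApp (N : RootObj F η p) (i : Fin p) {j l : Fin p} (f : j ⟶ l)
    (a b : Bool) (h : a ≤ b) (ha : step i j = a) (hb : step i l = b) :
    twistMap η (N.seq.obj i) a b h ≫ stairCounitApp N i l b =
      stairCounitApp N i j a ≫ N.seq.map f := by
  cases a <;> cases b
  · change 𝟙 (F.obj (N.seq.obj i)) ≫ F.map _ ≫ N.conn ≫ N.seq.map _ =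
      (F.map _ ≫ N.conn ≫ N.seq.map _) ≫ N.seq.map f
    rw [Category.id_comp, Category.assoc, Category.assoc, ← Functor.map_comp]
    rfl
  · rw [stairCounitApp_true N (step_eq_true_iff.1 hb)]
    change η.app (N.seq.obj i) ≫ _ = (F.map _ ≫ N.conn ≫ N.seq.map _) ≫ N.seq.map f
    rw [← N.cycle i, Category.assoc, Category.assoc, Category.assoc, Category.assoc,
      ← Functor.map_comp, ← Functor.map_comp]
    rfl
  · exact absurd h (by decide)
  · rw [stairCounitApp_true N (step_eq_true_iff.1 hb),
      stairCounitApp_true N (step_eq_true_iff.1 ha)]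
    exact (Category.id_comp _).trans (N.seq.map_comp _ _)

lemma map_stairCounitApp_conn (N : RootObj F η p) (i : Fin p)
    (a b : Bool) (ha : step i (⊤ : Fin p) = a) (hb : step i (⊥ : Fin p) = b) :
    F.map (stairCounitApp N i ⊤ a) ≫ N.conn =
      twistConn η (N.seq.obj i) a b ≫ stairCounitApp N i ⊥ b := by
  cases a
  · exact absurd (step_eq_false_iff.1 ha) (not_lt.2 (show i ≤ ⊤ from le_top))
  · rw [stairCounitApp_true N le_top]
    cases b
    · change _ = 𝟙 (F.obj (N.seq.obj i)) ≫ F.map _ ≫ N.conn ≫ N.seq.map (𝟙 _)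
      rw [N.seq.map_id, Category.id_comp, Category.comp_id]
      rfl
    · rw [stairCounitApp_true N (step_eq_true_iff.1 hb)]
      obtain rfl : i = ⊥ := le_bot_iff.1 (step_eq_true_iff.1 hb)
      change F.map (N.seq.map (homOfLE (le_top : ⊥ ≤ ⊤))) ≫ N.conn =
        η.app (N.seq.obj ⊥) ≫ N.seq.map (𝟙 ⊥)
      rw [← N.cycle ⊥, Category.assoc, Category.assoc, ← Functor.map_comp]
      change _ = F.map _ ≫ N.conn ≫ N.seq.map (𝟙 ⊥)
      rw [N.seq.map_id, Category.comp_id]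

lemma stairCounitApp_naturality {M N : RootObj F η p} (f : M ⟶ N) (i j : Fin p) (b : Bool) :
    (twist F b).map (f.seq.app i) ≫ stairCounitApp N i j b =
      stairCounitApp M i j b ≫ f.seq.app j := by
  cases b
  · change F.map (f.seq.app i) ≫ F.map _ ≫ N.conn ≫ N.seq.map _ =
      (F.map _ ≫ M.conn ≫ M.seq.map _) ≫ f.seq.app j
    rw [Category.assoc, Category.assoc, f.seq.naturality, ← f.comm_assoc, ← F.map_comp_assoc,
      ← F.map_comp_assoc, f.seq.naturality]
  · change f.seq.app i ≫ _ = _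
    by_cases h : i ≤ j
    · rw [stairCounitApp_true N h, stairCounitApp_true M h]
      exact (f.seq.naturality _).symm
    · have e : ∀ K : RootObj F η p, stairCounitApp K i j true = 0 := fun K => dif_neg h
      rw [e, e]
      exact comp_zero.trans zero_comp.symm

lemma twistUnit_comp_stairCounitApp (N : RootObj F η p) (i : Fin p) (b : Bool) (hb : b = true) :
    twistUnit F (N.seq.obj i) b ≫ stairCounitApp N i i b = 𝟙 _ := by
  subst hb
  rw [stairCounitApp_true N le_rfl]
  exact (Category.id_comp _).trans (N.seq.map_id i)

lemma map_twistUnit_comp_twistMap (X : C) (a b c d : Bool) (ha : a = true) (hb : b = true)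
    (hc : c = false) (hd : d = false) (h : a ≤ b) (h' : c ≤ d) :
    F.map (twistUnit F X a) ≫ F.map (twistMap η X a b h) ≫ twistConn η X b c ≫
      twistMap η X c d h' = twistMap η X false d (by simp [hd]) := by
  subst ha hb hc hd
  change F.map (𝟙 X) ≫ F.map (𝟙 X) ≫ 𝟙 (F.obj X) ≫ 𝟙 (F.obj X) = 𝟙 (F.obj X)
  simp

lemma map_twistUnit_comp_stairCounitApp (i j : Fin p) (X : C) (c : Bool) (hc : step i j = c) :
    (twist F c).map (twistUnit F X (step i i)) ≫
      stairCounitApp ((stair hη i).obj X) i j c = twistMap η X c (step i j) hc.ge := by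
  cases c
  · refine map_twistUnit_comp_twistMap X _ _ _ _ (step_eq_true_iff.2 le_rfl)
      (step_eq_true_iff.2 (show i ≤ ⊤ from le_top)) ?_ hc _ _
    rw [step_eq_false_iff] at hc ⊢
    exact lt_of_le_of_lt (show ⊥ ≤ j from bot_le) hc
  · rw [stairCounitApp_true _ (step_eq_true_iff.1 hc)]
    change twistUnit F X (step i i) ≫ twistMap η X (step i i) (step i j) _ = _
    have hi : step (i : ℕ) i = true := step_eq_true_iff.2 le_rfl
    have key : ∀ (a b : Bool) (ha : a = true) (h : a ≤ b) (h' : true ≤ b),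
        twistUnit F X a ≫ twistMap η X a b h = twistMap η X true b h' := by
      intro a b ha h h'
      subst ha
      exact Category.id_comp _
    exact key _ _ hi _ _

lemma twistUnit_naturality {X Y : C} (f : X ⟶ Y) (b : Bool) (hb : b = true) :
    f ≫ twistUnit F Y b = twistUnit F X b ≫ (twist F b).map f := by
  subst hb
  exact (Category.comp_id _).trans (Category.id_comp _).symm

lemma isIso_twistUnit (X : C) (b : Bool) (hb : b = true) : IsIso (twistUnit F X b) := by
  subst hb
  exact inferInstanceAs (IsIso (𝟙 X))

/-- The functor `stair i` is left adjoint to the evaluation at `i`. -/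
noncomputable def stairAdjunction (i : Fin p) : stair hη i ⊣ ev F η i :=
  Adjunction.mkOfUnitCounit
    { unit :=
        { app X := twistUnit F X (step i i)
          naturality _ _ f := twistUnit_naturality f _ (step_eq_true_iff.2 le_rfl) }
      counit :=
        { app N :=
            { seq :=
                { app j := stairCounitApp N i j (step i j)
                  naturality _ _ f := twistMap_stairCounitApp N i f _ _ _ rfl rfl }
              comm := map_stairCounitApp_conn N i _ _ rfl rfl }
          naturality _ _ f := by ext j; exact stairCounitApp_naturality f i j _ }
      left_triangle := by
        ext X j
        refine Eq.trans ?_ ((map_twistUnit_comp_stairCounitApp hη i j X _ rfl).trans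
          (twistMap_self η X _))
        exact congrArg (fun t => _ ≫ t) (Category.id_comp _)
      right_triangle := by
        ext N
        refine Eq.trans ?_ (twistUnit_comp_stairCounitApp N i (step i i) (step_eq_true_iff.2 le_rfl))
        exact congrArg (fun t => _ ≫ t) (Category.id_comp _) }

instance (i : Fin p) : IsIso (stairAdjunction (p := p) hη i).unit := by
  have : ∀ X, IsIso ((stairAdjunction (p := p) hη i).unit.app X) := fun X =>
    isIso_twistUnit X (step i i) (step_eq_true_iff.2 le_rfl)
  exact NatIso.isIso_of_isIso_app _

lemma isIso_stairAdjunction_counit_app (N : RootObj F η p) (i : Fin p)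
    (hi : ∀ j, i ≤ j) (h : ∀ j, IsIso (N.seq.map (homOfLE (hi j)))) :
    IsIso ((stairAdjunction hη i).counit.app N) := by
  refine isIso_of_ev _ fun j => ?_
  change IsIso (stairCounitApp N i j (step i j))
  generalize hb : step (i : ℕ) j = b
  cases b
  · exact absurd (hi j) (not_le.2 (step_eq_false_iff.1 hb))
  · rw [stairCounitApp_true N (hi j)]
    exact h j

lemma isIso_twistMap (X : C) {a b : Bool} (hab : a = b) (h : a ≤ b) :
    IsIso (twistMap η X a b h) := by
  subst hab
  rw [twistMap_self]
  infer_instance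

end StairAdjunction

/-! ### The objects `interval k l Y` -/

section Interval

variable {C : Type u} [Category.{v} C] [Abelian C] {F : C ⥤ C} [F.Additive]
  [PreservesFiniteLimits F] [PreservesFiniteColimits F] (η : F ⟶ 𝟭 C) {p : ℕ} [NeZero p]

instance : PreservesFiniteLimits (vanishing η).ι :=
  have := (vanishing η).preservesKernels_ι
  Functor.preservesFiniteLimits_of_preservesKernels _

instance : PreservesFiniteColimits (vanishing η).ι :=
  have := (vanishing η).preservesCokernels_ι
  Functor.preservesFiniteColimits_of_preservesCokernels _

open ZeroObject in
/-- The inclusion of `𝒜_η` for `true`, and the zero functor for `false`. -/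
noncomputable def cut : Bool → (VanishingCat η ⥤ C)
  | true => (vanishing η).ι
  | false => (Functor.const _).obj 0

variable {η}

lemma isZero_cut_false (Y : VanishingCat η) : IsZero ((cut η false).obj Y) := isZero_zero C

lemma app_cut_obj (Y : VanishingCat η) (b : Bool) : η.app ((cut η b).obj Y) = 0 := by
  cases b
  · exact (isZero_cut_false Y).eq_of_tgt _ _
  · exact Y.property

/-- The identity of `Y` if both ends are `Y`, and zero otherwise. -/
noncomputable def cutMap (Y : VanishingCat η) : ∀ a b : Bool, (cut η a).obj Y ⟶ (cut η b).obj Y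
  | true, true => 𝟙 _
  | _, _ => 0

lemma cutMap_self (Y : VanishingCat η) (a : Bool) : cutMap Y a a = 𝟙 _ := by
  cases a
  · exact (isZero_cut_false Y).eq_of_src _ _
  · rfl

lemma cutMap_comp (Y : VanishingCat η) (a b c : Bool) (h : a = true → c = true → b = true) :
    cutMap Y a b ≫ cutMap Y b c = cutMap Y a c := by
  cases a
  · exact (isZero_cut_false Y).eq_of_src _ _
  · cases c
    · exact (isZero_cut_false Y).eq_of_tgt _ _
    · obtain rfl := h rfl rfl
      exact Category.comp_id _

lemma cutMap_comp_cutMap (Y : VanishingCat η) (a b a' b' : Bool)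
    (h : a = true → b' = true → a' = b) :
    cutMap Y a a' ≫ cutMap Y a' b' = cutMap Y a b ≫ cutMap Y b b' := by
  cases a
  · exact (isZero_cut_false Y).eq_of_src _ _
  · cases b'
    · exact (isZero_cut_false Y).eq_of_tgt _ _
    · rw [h rfl rfl]

lemma cutMap_naturality {Y Y' : VanishingCat η} (f : Y ⟶ Y') (a b : Bool) :
    cutMap Y a b ≫ (cut η b).map f = (cut η a).map f ≫ cutMap Y' a b := by
  cases a
  · exact (isZero_cut_false Y).eq_of_src _ _
  · cases b
    · exact (isZero_cut_false Y').eq_of_tgt _ _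
    · exact (Category.id_comp _).trans (Category.comp_id _).symm

/-- Whether `k ≤ j < l`. -/
def inside (k l : ℕ) (j : Fin p) : Bool := decide (k ≤ j ∧ (j : ℕ) < l)

omit [NeZero p] in
lemma inside_eq_true_iff {k l : ℕ} {j : Fin p} : inside k l j = true ↔ k ≤ j ∧ (j : ℕ) < l :=
  decide_eq_true_iff

/-- The functor `Y ↦ (0 ⟶ ⋯ ⟶ 0 ⟶ Y = ⋯ = Y ⟶ 0 ⟶ ⋯ ⟶ 0)`, with `Y` at the positions
`k ≤ j < l` and `f₁ = 0`; the cycle condition holds since `η(Y) = 0`. -/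
noncomputable def interval (k l : ℕ) : VanishingCat η ⥤ RootObj F η p where
  obj Y :=
    { seq :=
        { obj j := (cut η (inside k l j)).obj Y
          map {i j} _ := cutMap Y (inside k l i) (inside k l j)
          map_id _ := cutMap_self Y _
          map_comp {i j m} f g := (cutMap_comp Y _ _ _ fun hi hm => by
            rw [inside_eq_true_iff] at hi hm ⊢
            have h₁ : (i : ℕ) ≤ j := f.le
            have h₂ : (j : ℕ) ≤ m := g.le
            lia).symm }
      conn := 0
      cycle j := by rw [app_cut_obj, zero_comp, comp_zero] }
  map f :=
    { seq :=
        { app j := (cut η (inside k l j)).map f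
          naturality _ _ _ := cutMap_naturality f _ _ }
      comm := by rw [zero_comp, comp_zero] }
  map_id Y := by ext; exact (cut η _).map_id Y
  map_comp f g := by ext; exact (cut η _).map_comp f g

/-- The morphism equal to the identity of `Y` on the common positions. The hypothesis on the intervals
makes it compatible with the transition morphisms. -/
noncomputable def intervalMap (k l k' l' : ℕ) (h : ∀ i j : Fin p, i ≤ j → inside k l i = true →
    inside k' l' j = true → inside k l j = inside k' l' i) :
    interval (F := F) (η := η) (p := p) k l ⟶ interval k' l' where
  app Y :=
    { seq :=
        { app j := cutMap Y (inside k l j) (inside k' l' j)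
          naturality i j f := cutMap_comp_cutMap Y _ _ _ _ (h i j f.le) }
      comm := comp_zero.trans zero_comp.symm }
  naturality _ _ f := by ext; exact (cutMap_naturality f _ _).symm

instance (b : Bool) : PreservesFiniteLimits (cut η b) := by
  cases b
  · have : IsZero (cut η false) := Functor.isZero _ isZero_cut_false
    exact ⟨fun J _ _ => Functor.preservesLimitsOfShape_of_isZero _ this J⟩
  · exact inferInstanceAs (PreservesFiniteLimits (vanishing η).ι)

instance (b : Bool) : PreservesFiniteColimits (cut η b) := by
  cases b
  · have : IsZero (cut η false) := Functor.isZero _ isZero_cut_false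
    exact ⟨fun J _ _ => Functor.preservesColimitsOfShape_of_isZero _ this J⟩
  · exact inferInstanceAs (PreservesFiniteColimits (vanishing η).ι)

instance (b : Bool) : (cut η b).Additive := by
  cases b
  · exact ⟨fun {Y _ _ _} => (isZero_cut_false Y).eq_of_src _ _⟩
  · exact inferInstanceAs (vanishing η).ι.Additive

instance (k l : ℕ) : PreservesFiniteLimits (interval (F := F) (η := η) (p := p) k l) :=
  preservesFiniteLimits_of_ev (F := F) (η := η) _ fun j =>
    inferInstanceAs (PreservesFiniteLimits (cut η (inside k l j)))

instance (k l : ℕ) : PreservesFiniteColimits (interval (F := F) (η := η) (p := p) k l) :=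
  preservesFiniteColimits_of_ev (F := F) (η := η) _ fun j =>
    inferInstanceAs (PreservesFiniteColimits (cut η (inside k l j)))

instance (k l : ℕ) : (interval (F := F) (η := η) (p := p) k l).Additive :=
  additive_of_ev (F := F) (η := η) _ fun j => inferInstanceAs ((cut η (inside k l j)).Additive)

/-! ### Morphisms from `stair k X` to `interval k l Y` -/

variable (hη : ∀ X, F.map (η.app X) = η.app (F.obj X))

/-- The components of `stairToInterval`: `f` where the two objects have the values `X` and `Y`, and zero
elsewhere. -/
noncomputable def twistCut {X : C} {Y : VanishingCat η} (f : X ⟶ Y.obj) :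
    ∀ a b : Bool, (twist F a).obj X ⟶ (cut η b).obj Y
  | true, true => f
  | _, _ => 0

lemma app_comp_eq_zero {X : C} {Y : VanishingCat η} (f : X ⟶ Y.obj) : η.app X ≫ f = 0 := by
  have h : F.map f ≫ η.app Y.obj = η.app X ≫ f := η.naturality f
  have hY : η.app Y.obj = 0 := Y.property
  rw [← h, hY, comp_zero]

lemma twistCut_naturality {X : C} {Y : VanishingCat η} (f : X ⟶ Y.obj) (a b a' b' : Bool)
    (haa : a ≤ a') (h : a = true → b = false → b' = false) :
    twistMap η X a a' haa ≫ twistCut f a' b' = twistCut f a b ≫ cutMap Y b b' := by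
  cases b'
  · exact (isZero_cut_false Y).eq_of_tgt _ _
  · cases a
    · cases a'
      · exact comp_zero.trans zero_comp.symm
      · exact (app_comp_eq_zero f).trans zero_comp.symm
    · cases b
      · exact absurd (h rfl rfl) (by decide)
      · cases a'
        · exact absurd haa (by decide)
        · exact (Category.id_comp _).trans (Category.comp_id _).symm

lemma twistConn_comp_twistCut {X : C} {Y : VanishingCat η} (f : X ⟶ Y.obj) (a b c : Bool)
    (h : b = true → a = true) :
    twistConn η X a b ≫ twistCut f b c = 0 := by
  cases c
  · exact (isZero_cut_false Y).eq_of_tgt _ _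
  · cases b
    · exact comp_zero
    · obtain rfl := h rfl
      exact app_comp_eq_zero f

lemma twistMap_comp_twistCut {X : C} {Y : VanishingCat η} (f : X ⟶ Y.obj) (a b c : Bool)
    (h : a ≤ b) (hc : c = true → a = false) : twistMap η X a b h ≫ twistCut f b c = 0 := by
  cases c
  · exact (isZero_cut_false Y).eq_of_tgt _ _
  · obtain rfl := hc rfl
    cases b
    · exact comp_zero
    · exact app_comp_eq_zero f

/-- The morphism `stair k X ⟶ interval k l Y` induced by `f : X ⟶ Y`. -/
noncomputable def stairToInterval (k l : ℕ) {X : C} {Y : VanishingCat η} (f : X ⟶ Y.obj) :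
    (stair (p := p) hη k).obj X ⟶ (interval k l).obj Y where
  seq :=
    { app j := twistCut f (step k j) (inside k l j)
      naturality i j g := twistCut_naturality f _ _ _ _ _ fun hi hi' => by
        rw [step_eq_true_iff] at hi
        rw [← Bool.not_eq_true, inside_eq_true_iff] at hi' ⊢
        have : (i : ℕ) ≤ j := g.le
        lia }
  comm := comp_zero.trans (twistConn_comp_twistCut f _ _ _ fun h =>
    step_eq_true_iff.2 ((step_eq_true_iff.1 h).trans (bot_le : (⊥ : Fin p) ≤ ⊤))).symm

/-- The cokernel of `η(X)`, an object of `𝒜_η`. -/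
noncomputable def cokernelApp (X : C) : VanishingCat η :=
  ⟨cokernel (η.app X), by
    have h : F.map (cokernel.π (η.app X)) ≫ η.app (cokernel (η.app X)) =
      η.app X ≫ cokernel.π (η.app X) := η.naturality _
    rw [cokernel.condition] at h
    exact (cancel_epi (F.map (cokernel.π (η.app X)))).1 (h.trans comp_zero.symm)⟩

/-- The projection of `X` onto the cokernel of `η(X)`. -/
noncomputable def cokernelAppπ (X : C) : X ⟶ (cokernelApp (η := η) X).obj := cokernel.π (η.app X)

lemma stairMap_comp_stairToInterval (k : ℕ) {X : C} {Y : VanishingCat η} (f : X ⟶ Y.obj) :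
    (stairMap (p := p) hη k.le_succ).app X ≫ stairToInterval hη k (k + 1) f = 0 := by
  ext j
  change twistMap η X (step (k + 1) j) (step k j) _ ≫
    twistCut f (step k j) (inside k (k + 1) j) = 0
  refine twistMap_comp_twistCut f _ _ _ _ fun hc => ?_
  rw [inside_eq_true_iff] at hc
  rw [step_eq_false_iff]
  lia

lemma shortExact_of_isIso_of_isZero {D : Type*} [Category* D] [Abelian D] {S : ShortComplex D}
    (h : IsIso S.f) (h' : IsZero S.X₃) : S.ShortExact where
  exact := (S.exact_iff_epi (h'.eq_of_tgt _ _)).2 inferInstance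
  mono_f := inferInstance
  epi_g := ⟨fun _ _ _ => h'.eq_of_src _ _⟩

lemma stair_shortExact (k : ℕ) (X : C) [hX : Mono (η.app X)] :
    (ShortComplex.mk ((stairMap (p := p) hη k.le_succ).app X)
      (stairToInterval hη k (k + 1) (cokernelAppπ (η := η) X))
      (stairMap_comp_stairToInterval hη k _)).ShortExact := by
  refine shortExact_of_ev fun j => ?_
  have key : ∀ (a b c : Bool) (hab : a ≤ b) (w : twistMap η X a b hab ≫
      twistCut (cokernelAppπ (η := η) X) b c = 0), (c = true ↔ a ≠ b) →
      (ShortComplex.mk (twistMap η X a b hab) (twistCut (cokernelAppπ (η := η) X) b c)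
        w).ShortExact := by
    intro a b c hab w h
    cases c
    · obtain rfl : a = b := by by_contra h'; simpa using h.2 h'
      exact shortExact_of_isIso_of_isZero (isIso_twistMap (η := η) X rfl _)
        (isZero_cut_false (cokernelApp (η := η) X))
    · cases a <;> cases b
      · exact absurd rfl (h.1 rfl)
      · exact
          { exact := ShortComplex.exact_cokernel (η.app X)
            mono_f := hX
            epi_g := inferInstanceAs (Epi (cokernel.π (η.app X))) }
      · exact absurd hab (by decide)
      · exact absurd rfl (h.1 rfl)
  refine key (step (k + 1) j) (step k j) (inside k (k + 1) j) _ _ ?_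
  rw [inside_eq_true_iff, step, step, ne_eq, decide_eq_decide]
  lia
end Interval

/-! ### Dévissage -/

section Devissage

variable {C : Type u} [Category.{v} C] [Abelian C] {F : C ⥤ C} [F.Additive]
  [PreservesFiniteLimits F] [PreservesFiniteColimits F] {η : F ⟶ 𝟭 C} {p : ℕ} [NeZero p]

lemma cutMap_comp_eq_zero (Y : VanishingCat η) (a b c : Bool) (h : a = true → c = false) :
    cutMap Y a b ≫ cutMap Y b c = 0 := by
  cases a
  · exact (isZero_cut_false Y).eq_of_src _ _
  · obtain rfl := h rfl
    exact (isZero_cut_false Y).eq_of_tgt _ _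

lemma cutMap_shortExact (Y : VanishingCat η) (a b c : Bool) (w : cutMap Y a b ≫ cutMap Y b c = 0)
    (hac : a = true → c = false) (hb : b = true ↔ a = true ∨ c = true) :
    (ShortComplex.mk (cutMap Y a b) (cutMap Y b c) w).ShortExact := by
  cases a
  · obtain rfl : b = c := by
      cases b <;> cases c <;> simp at hb <;> rfl
    exact
      { exact := (ShortComplex.exact_iff_mono _ ((isZero_cut_false Y).eq_of_src _ _)).2
          (by dsimp; rw [cutMap_self]; infer_instance)
        mono_f := ⟨fun _ _ _ => (isZero_cut_false Y).eq_of_tgt _ _⟩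
        epi_g := by dsimp; rw [cutMap_self]; infer_instance }
  · obtain rfl := hac rfl
    obtain rfl := hb.2 (Or.inl rfl)
    exact shortExact_of_isIso_of_isZero (inferInstanceAs (IsIso (𝟙 _))) (isZero_cut_false Y)

variable (η p) in
/-- The inclusion of `interval l m Y` into `interval k m Y`. -/
noncomputable abbrev intervalι {k l : ℕ} (m : ℕ) (h : k ≤ l) :
    interval (F := F) (η := η) (p := p) l m ⟶ interval k m :=
  intervalMap l m k m fun i j hij hi hj => by
    rw [inside_eq_true_iff] at hi hj
    have : (i : ℕ) ≤ j := hij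
    rw [inside_eq_true_iff.2 (by lia), inside_eq_true_iff.2 (by lia)]

variable (η p) in
/-- The projection of `interval k m Y` onto `interval k l Y`. -/
noncomputable abbrev intervalπ (k : ℕ) {l m : ℕ} (h : l ≤ m) :
    interval (F := F) (η := η) (p := p) k m ⟶ interval k l :=
  intervalMap k m k l fun i j hij hi hj => by
    rw [inside_eq_true_iff] at hi hj
    have : (i : ℕ) ≤ j := hij
    rw [inside_eq_true_iff.2 (by lia), inside_eq_true_iff.2 (by lia)]

omit [NeZero p] in
lemma inside_eq_false_of_inside {k l m : ℕ} {j : Fin p} (h : inside l m j = true) :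
    inside k l j = false := by
  rw [inside_eq_true_iff] at h
  rw [← Bool.not_eq_true, inside_eq_true_iff]
  lia

lemma intervalι_comp_intervalπ {k l m : ℕ} (hkl : k ≤ l) (hlm : l ≤ m) (Y : VanishingCat η) :
    (intervalι η p m hkl).app Y ≫ (intervalπ η p k hlm).app Y = 0 := by
  ext j
  exact cutMap_comp_eq_zero Y _ _ _ inside_eq_false_of_inside

lemma interval_shortExact {k l m : ℕ} (hkl : k ≤ l) (hlm : l ≤ m) (Y : VanishingCat η) :
    (ShortComplex.mk ((intervalι η p m hkl).app Y) ((intervalπ η p k hlm).app Y)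
      (intervalι_comp_intervalπ hkl hlm Y)).ShortExact := by
  refine shortExact_of_ev fun j => ?_
  refine cutMap_shortExact Y (inside l m j) (inside k m j) (inside k l j) _
    inside_eq_false_of_inside ?_
  simp only [inside_eq_true_iff]
  lia

variable (hη : ∀ X, F.map (η.app X) = η.app (F.obj X))

/-- The components of `simpleToStair`: `g` where the two objects have the values `Y` and `F X`, and zero
elsewhere. -/
noncomputable def cutTwist {X : C} {Y : VanishingCat η} (g : Y.obj ⟶ F.obj X) :
    ∀ a b : Bool, (cut η a).obj Y ⟶ (twist F b).obj X
  | true, false => g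
  | _, _ => 0

lemma cutTwist_naturality {X : C} (hX : η.app X = 0) {Y : VanishingCat η} (g : Y.obj ⟶ F.obj X)
    (a b a' b' : Bool) (h : b ≤ b') (ha : a = true → a' = false → b' = true)
    (hb : a = true → b = false) :
    cutMap Y a a' ≫ cutTwist g a' b' = cutTwist g a b ≫ twistMap η X b b' h := by
  cases a
  · exact (isZero_cut_false Y).eq_of_src _ _
  · obtain rfl := hb rfl
    cases b'
    · cases a'
      · exact absurd (ha rfl rfl) (by decide)
      · exact (Category.id_comp _).trans (Category.comp_id _).symm
    · have e : twistMap η X false true h = 0 := hX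
      have e' : cutTwist g a' true = 0 := by cases a' <;> rfl
      rw [e, e', comp_zero, comp_zero]

include hη in
lemma map_cutTwist_comp_twistConn {X : C} (hX : η.app X = 0) {Y : VanishingCat η}
    (g : Y.obj ⟶ F.obj X) (a b c : Bool) (h : b = false → c = false) :
    F.map (cutTwist g a b) ≫ twistConn η X b c = 0 := by
  cases b
  · obtain rfl := h rfl
    have e : twistConn η X false false = 0 := (hη X).symm.trans
      ((congrArg F.map hX).trans (F.map_zero _ _))
    rw [e, comp_zero]
  · have e : cutTwist g a true = 0 := by cases a <;> rfl
    rw [e, F.map_zero, zero_comp]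

/-- When `η(X) = 0`, the position `k` is the last one at which `stair (k + 1) X` has the value `F X`, and
the transition morphism to the next position is zero. So a morphism `g : Y ⟶ F X` induces a morphism
`interval k (k + 1) Y ⟶ stair (k + 1) X`. -/
noncomputable def simpleToStair (k : ℕ) {X : C} (hX : η.app X = 0) {Y : VanishingCat η}
    (g : Y.obj ⟶ F.obj X) : (interval k (k + 1)).obj Y ⟶ (stair (p := p) hη (k + 1)).obj X where
  seq :=
    { app j := cutTwist g (inside k (k + 1) j) (step (k + 1) j)
      naturality i j f := by
        have hij : (i : ℕ) ≤ j := f.le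
        refine cutTwist_naturality hX g _ _ _ _ _ (fun hi hj => ?_) fun hi => ?_
        · rw [inside_eq_true_iff] at hi
          rw [← Bool.not_eq_true, inside_eq_true_iff] at hj
          rw [step_eq_true_iff]
          lia
        · rw [inside_eq_true_iff] at hi
          rw [step_eq_false_iff]
          lia }
  comm := (map_cutTwist_comp_twistConn hη hX g _ _ _ fun h => by
    rw [step_eq_false_iff] at h ⊢
    exact lt_of_le_of_lt (show (⊥ : Fin p) ≤ ⊤ from bot_le) h).trans zero_comp.symm

lemma mono_simpleToStair (k : ℕ) {X : C} (hX : η.app X = 0) {Y : VanishingCat η}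
    (g : Y.obj ⟶ F.obj X) [hg : Mono g] : Mono (simpleToStair (p := p) hη k hX g) := by
  refine mono_of_ev _ fun j => ?_
  have key : ∀ a b : Bool, (a = true → b = false) → Mono (cutTwist g a b) := by
    intro a b h
    cases a
    · exact ⟨fun _ _ _ => (isZero_cut_false Y).eq_of_tgt _ _⟩
    · obtain rfl := h rfl
      exact hg
  refine key _ _ fun h => ?_
  rw [inside_eq_true_iff] at h
  rw [step_eq_false_iff]
  lia

/-- The components of `toStair`; only the value at `true` is used. -/
noncomputable def toTwist (M : RootObj F η p) (j : Fin p) :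
    ∀ b : Bool, M.seq.obj j ⟶ (twist F b).obj (M.seq.obj ⊤)
  | true => M.seq.map (homOfLE le_top)
  | false => 0

lemma toTwist_naturality (M : RootObj F η p) {i j : Fin p} (f : i ⟶ j) (a b : Bool) (h : a ≤ b)
    (ha : a = true) :
    M.seq.map f ≫ toTwist M j b = toTwist M i a ≫ twistMap η (M.seq.obj ⊤) a b h := by
  subst ha
  cases b
  · exact absurd h (by decide)
  · exact (M.seq.map_comp _ _).symm.trans (Category.comp_id _).symm

lemma map_toTwist_comp_twistConn (M : RootObj F η p) (a b : Bool) (ha : a = true) (hb : b = true) :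
    F.map (toTwist M ⊤ a) ≫ twistConn η (M.seq.obj ⊤) a b = M.conn ≫ toTwist M ⊥ b := by
  subst ha hb
  have h := M.cycle ⊤
  have e : M.seq.map (homOfLE (le_top : (⊤ : Fin p) ≤ ⊤)) = 𝟙 _ := M.seq.map_id ⊤
  rw [e, F.map_id, Category.id_comp] at h
  change F.map (M.seq.map (homOfLE (le_top : (⊤ : Fin p) ≤ ⊤))) ≫ η.app (M.seq.obj ⊤) =
    M.conn ≫ M.seq.map (homOfLE le_top)
  rw [e, F.map_id, Category.id_comp]
  exact h.symm

/-- The canonical morphism from `M` to the constant sequence on its last term, given by the transition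
morphisms `M_j ⟶ M_⊤`. -/
noncomputable def toStair (M : RootObj F η p) : M ⟶ (stair hη 0).obj (M.seq.obj ⊤) where
  seq :=
    { app j := toTwist M j (step 0 j)
      naturality i j f := toTwist_naturality M f (step 0 i) (step 0 j) (step_mono 0 f.le)
        ((step_eq_true_iff (k := 0) (j := i)).2 (Nat.zero_le _)) }
  comm := map_toTwist_comp_twistConn M (step 0 (⊤ : Fin p)) (step 0 (⊥ : Fin p))
    (step_eq_true_iff.2 (Nat.zero_le _)) (step_eq_true_iff.2 (Nat.zero_le _))

lemma isIso_toStair_app_top (M : RootObj F η p) : IsIso ((toStair hη M).seq.app ⊤) := by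
  have key : ∀ b : Bool, b = true → IsIso (toTwist M ⊤ b) := by
    rintro _ rfl
    exact inferInstanceAs (IsIso (M.seq.map (𝟙 ⊤)))
  exact key (step 0 (⊤ : Fin p)) (step_eq_true_iff.2 (Nat.zero_le _))

lemma app_eq_zero_of_conn_eq_zero {N : RootObj F η p} (hN : N.conn = 0) (j : Fin p) :
    η.app (N.seq.obj j) = 0 := by
  rw [← N.cycle j, hN, zero_comp, comp_zero]

open Classical in
/-- The components of `toSimple`; the value at `true` is used for `j = k` only. -/
noncomputable def toCut {N : RootObj F η p} (hN : N.conn = 0) (k j : Fin p) :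
    ∀ b : Bool, N.seq.obj j ⟶
      (cut η b).obj (⟨N.seq.obj k, app_eq_zero_of_conn_eq_zero hN k⟩ : VanishingCat η)
  | true => if h : j ≤ k then N.seq.map (homOfLE h) else 0
  | false => 0

lemma toCut_true {N : RootObj F η p} (hN : N.conn = 0) {k j : Fin p} (h : j ≤ k) :
    toCut hN k j true = N.seq.map (homOfLE h) := dif_pos h

lemma inside_self_iff {k j : Fin p} : inside k (k + 1) j = true ↔ j = k := by
  rw [inside_eq_true_iff, Fin.ext_iff]
  lia

/-- The projection of `N` onto its term at the position `k`, when all previous terms vanish. -/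
noncomputable def toSimple {N : RootObj F η p} (hN : N.conn = 0) (k : Fin p)
    (hk : ∀ j < k, IsZero (N.seq.obj j)) :
    N ⟶ (interval k (k + 1)).obj ⟨N.seq.obj k, app_eq_zero_of_conn_eq_zero hN k⟩ where
  seq :=
    { app j := toCut hN k j (inside k (k + 1) j)
      naturality i j f := by
        have key : ∀ a b : Bool, inside k (k + 1) i = a → inside k (k + 1) j = b →
            N.seq.map f ≫ toCut hN k j b = toCut hN k i a ≫ cutMap _ a b := by
          intro a b ha hb
          cases b
          · exact (isZero_cut_false _).eq_of_tgt _ _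
          · obtain rfl := inside_self_iff.1 hb
            cases a
            · refine (hk i (lt_of_le_of_ne f.le fun h => ?_)).eq_of_src _ _
              rw [inside_self_iff.2 h] at ha
              exact absurd ha (by decide)
            · obtain rfl := inside_self_iff.1 ha
              rw [toCut_true hN le_rfl]
              exact (N.seq.map_comp _ _).symm.trans (Category.comp_id _).symm
        exact key _ _ rfl rfl }
  comm := by rw [hN]; exact comp_zero.trans zero_comp.symm

lemma toCut_epi {N : RootObj F η p} (hN : N.conn = 0) (k j : Fin p) (b : Bool)
    (hb : inside k (k + 1) j = b) : Epi (toCut hN k j b) := by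
  cases b
  · exact ⟨fun _ _ _ => (isZero_cut_false _).eq_of_src _ _⟩
  · obtain rfl := inside_self_iff.1 hb
    rw [toCut_true hN le_rfl]
    exact inferInstanceAs (Epi (N.seq.map (𝟙 j)))

lemma toCut_mono {N : RootObj F η p} (hN : N.conn = 0) (k : Fin p) (b : Bool) (hb : b = true) :
    Mono (toCut hN k k b) := by
  subst hb
  rw [toCut_true hN le_rfl]
  exact inferInstanceAs (Mono (N.seq.map (𝟙 k)))

/-- The objects with `f₁ = 0` are iterated extensions of objects `interval k (k + 1) Y`. -/
lemma prop_of_conn_eq_zero (P : RootObj F η p → Prop)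
    (hP₀ : ∀ M, IsZero M → P M)
    (hP : ∀ S : ShortComplex (RootObj F η p), S.ShortExact → P S.X₁ → P S.X₃ → P S.X₂)
    (hS : ∀ (k : Fin p) (Y : VanishingCat η), P ((interval k (k + 1)).obj Y))
    (N : RootObj F η p) (hN : N.conn = 0) : P N := by
  -- Induction on the number `d` of positions, counted from the end, outside of which `N` vanishes.
  have key : ∀ (d : ℕ) (N : RootObj F η p), N.conn = 0 →
      (∀ j : Fin p, (j : ℕ) + d < p → IsZero (N.seq.obj j)) → P N := by
    intro d
    induction d with
    | zero => exact fun N _ h => hP₀ N (isZero_of_ev fun j => h j j.2)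
    | succ d ih =>
      intro N hN h
      by_cases hd : d < p
      · let k : Fin p := ⟨p - (d + 1), by lia⟩
        have hk : ∀ j < k, IsZero (N.seq.obj j) := fun j hj => h j (by
          have : (j : ℕ) < p - (d + 1) := hj
          lia)
        let f := toSimple hN k hk
        have : Epi f := epi_of_ev _ fun j => toCut_epi hN k j _ rfl
        have hf : (ShortComplex.mk (kernel.ι f) f (kernel.condition f)).ShortExact :=
          { exact := ShortComplex.exact_kernel f }
        refine hP _ hf (ih _ ?_ fun j hj => ?_) (hS k _)
        · have e := (kernel.ι f).comm
          rw [hN, comp_zero] at e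
          exact (cancel_mono ((kernel.ι f).seq.app ⊥)).1 (e.symm.trans zero_comp.symm)
        · have hjk : j ≤ k := show (j : ℕ) ≤ p - (d + 1) by lia
          suffices (kernel.ι f).seq.app j = 0 from IsZero.of_mono_eq_zero _ this
          rcases hjk.lt_or_eq with hjk | rfl
          · exact (hk j hjk).eq_of_tgt _ _
          · have e : (kernel.ι f ≫ f).seq.app k = 0 := by rw [kernel.condition]; rfl
            have := toCut_mono hN k _ (inside_self_iff.2 rfl : inside (k : ℕ) (k + 1) k = true)
            exact (cancel_mono (toCut hN k k (inside k (k + 1) k))).1 (e.trans zero_comp.symm)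
      · exact ih N hN fun j hj => by lia
  exact key p N hN fun j hj => by lia

end Devissage

end RootObj

/-! ### Bounds for the global dimension -/

section GlobalDimension

variable {C : Type u} [Category.{v} C] [Abelian C]

lemma CategoryTheory.HasProjectiveDimensionLT.of_le {X : C} {n m : ℕ}
    (h : HasProjectiveDimensionLT X n) (hnm : n ≤ m) : HasProjectiveDimensionLT X m :=
  hasProjectiveDimensionLT_of_ge X n m hnm

lemma hasProjectiveDimensionLT_of_globalDimension_lt {n : ℕ} (h : globalDimension C < n) (X : C) :
    HasProjectiveDimensionLT X n :=
  projectiveDimension_lt_iff.1 ((le_iSup _ X).trans_lt h)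

lemma globalDimension_le_iff {d : WithBot ℕ∞} :
    globalDimension C ≤ d ↔ ∀ n : ℕ, d < n → ∀ X : C, HasProjectiveDimensionLT X n :=
  ⟨fun h _ hn X => hasProjectiveDimensionLT_of_globalDimension_lt (h.trans_lt hn) X,
    fun h => iSup_le fun X => sInf_le fun n hn => h n hn X⟩

lemma globalDimension_lt_natCast {n : ℕ} (h : ∀ X : C, HasProjectiveDimensionLT X n) :
    globalDimension C < n := by
  cases n with
  | zero =>
    refine (globalDimension_le_iff (d := ⊥).2 fun n _ X => ?_).trans_lt (WithBot.bot_lt_coe _)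
    have := h X
    exact hasProjectiveDimensionLT_of_ge X 0 n (Nat.zero_le n)
  | succ k =>
    refine (globalDimension_le_iff (d := (k : WithBot ℕ∞)).2 fun n hn X => ?_).trans_lt
      (by exact_mod_cast Nat.lt_succ_self k)
    have := h X
    have hn' : k < n := by exact_mod_cast hn
    exact hasProjectiveDimensionLT_of_ge X (k + 1) n hn'

lemma le_add_one_withBot (a : WithBot ℕ∞) : a ≤ a + 1 := by
  induction a using WithBot.recBotCoe with
  | bot => exact bot_le
  | coe a => exact WithBot.coe_le_coe.2 le_self_add

lemma add_one_lt_natCast_iff {a : WithBot ℕ∞} {n : ℕ} :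
    a + 1 < ((n + 1 : ℕ) : WithBot ℕ∞) ↔ a < n := by
  induction a using WithBot.recBotCoe with
  | bot => simp [WithBot.bot_lt_iff_ne_bot]
  | coe a =>
    induction a using ENat.recTopCoe with
    | top =>
      exact iff_of_false (not_lt.2 le_top) (not_lt.2 le_top)
    | coe a => norm_cast; lia

lemma add_one_le_natCast_of_lt {a : WithBot ℕ∞} {n : ℕ} (h : a < n) :
    a + 1 ≤ (n : WithBot ℕ∞) := by
  induction a using WithBot.recBotCoe with
  | bot => exact bot_le
  | coe a =>
    induction a using ENat.recTopCoe with
    | top => exact absurd h (not_lt.2 le_top)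
    | coe a => exact_mod_cast h

/-- The truncated subtraction `n - 1` is intended: for `n = 0` the hypothesis still says that every object
is zero. -/
lemma globalDimension_add_one_le {d : WithBot ℕ∞}
    (h : ∀ n : ℕ, d < n → ∀ X : C, HasProjectiveDimensionLT X (n - 1)) :
    globalDimension C + 1 ≤ d := by
  induction d using WithBot.recBotCoe with
  | bot =>
    have hC := globalDimension_lt_natCast (h 0 (WithBot.bot_lt_coe _))
    have e : globalDimension C = ⊥ := by
      by_contra h'
      obtain ⟨a, ha⟩ := WithBot.ne_bot_iff_exists.1 h'
      rw [← ha] at hC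
      exact not_lt_bot (WithBot.coe_lt_coe.1 hC)
    rw [e]
    exact le_rfl
  | coe a =>
    induction a using ENat.recTopCoe with
    | top => exact le_top
    | coe a =>
      have hC := globalDimension_lt_natCast (h (a + 1) (by exact_mod_cast Nat.lt_succ_self a))
      exact add_one_le_natCast_of_lt hC

end GlobalDimension

namespace RootObj

/-! ### The upper bound -/

section Dimension

variable {C : Type u} [Category.{v} C] [Abelian C] {F : C ⥤ C} [F.Additive]
  [PreservesFiniteLimits F] [PreservesFiniteColimits F] {η : F ⟶ 𝟭 C} {p : ℕ} [NeZero p]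

/-- The two morphisms `F F X ⟶ F X` given by `η` agree: on objects `M` with `η(M)` mono this follows
from naturality, and every object is a quotient of such an `M`. -/
lemma map_app_eq_app_obj (h : ∀ X : C, ∃ (M : C) (q : M ⟶ X), Epi q ∧ Mono (η.app M)) (X : C) :
    F.map (η.app X) = η.app (F.obj X) := by
  obtain ⟨M, q, hq, hM⟩ := h X
  have e : F.map (η.app M) = η.app (F.obj M) :=
    (cancel_mono (η.app M)).1 (η.naturality (η.app M))
  have h₁ : F.map q ≫ η.app X = η.app M ≫ q := η.naturality q
  have h₂ : F.map (F.map q) ≫ η.app (F.obj X) = η.app (F.obj M) ≫ F.map q := η.naturality (F.map q)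
  exact (cancel_epi (F.map (F.map q))).1 (by rw [h₂, ← F.map_comp, h₁, F.map_comp, e])

lemma conn_eq_zero_of_isZero {N : RootObj F η p} (h : IsZero (N.seq.obj ⊤)) : N.conn = 0 :=
  (F.map_isZero h).eq_of_src _ _

variable (hη : ∀ X, F.map (η.app X) = η.app (F.obj X))

open Abelian

/-- For `k < p` by the adjunction. The sequence `stair p X` is constant, with all transition morphisms
invertible, and so is isomorphic to `stair 0` of its first term. -/
lemma hasProjectiveDimensionLT_stair {k m : ℕ} (hk : k ≤ p)
    (hC : ∀ X : C, HasProjectiveDimensionLT X m) (X : C) :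
    HasProjectiveDimensionLT ((stair (p := p) hη k).obj X) m := by
  let := HasExt.standard C
  let := HasExt.standard (RootObj F η p)
  have key : ∀ (i : Fin p) (X : C), HasProjectiveDimensionLT ((stair (p := p) hη i).obj X) m :=
    fun i X => by
      have := hC X
      exact hasProjectiveDimensionLT_obj_of_adjunction (stairAdjunction hη i) X m
  rcases hk.lt_or_eq with hk | rfl
  · exact key ⟨k, hk⟩ X
  · have hf : ∀ j : Fin k, step k j = false := fun j : Fin k => step_eq_false_iff.2 j.2
    have : IsIso ((stairAdjunction hη (⊥ : Fin k)).counit.app ((stair hη k).obj X)) :=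
      isIso_stairAdjunction_counit_app hη _ ⊥ (fun _ => bot_le) fun j =>
        isIso_twistMap X ((hf (⊥ : Fin k)).trans (hf j).symm) (step_mono k bot_le)
    have : HasProjectiveDimensionLT ((ev F η (⊥ : Fin k) ⋙ stair hη (⊥ : Fin k)).obj
        ((stair hη k).obj X)) m := key (⊥ : Fin k) ((ev F η (⊥ : Fin k)).obj ((stair hη k).obj X))
    exact hasProjectiveDimensionLT_of_iso
      (asIso ((stairAdjunction hη (⊥ : Fin k)).counit.app ((stair hη k).obj X))) m

include hη in
/-- Projective dimensions are bounded by those of the objects of `𝒜` and of the objects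
`interval k (k + 1) Y`: the kernel and the cokernel of `toStair hη M` vanish at the last position. -/
lemma hasProjectiveDimensionLT_of_interval {m : ℕ}
    (hC : ∀ X : C, HasProjectiveDimensionLT X m)
    (hS : ∀ (k : Fin p) (Y : VanishingCat η),
      HasProjectiveDimensionLT ((interval (F := F) (p := p) k (k + 1)).obj Y) m)
    (M : RootObj F η p) : HasProjectiveDimensionLT M m := by
  have key : ∀ N : RootObj F η p, N.conn = 0 → HasProjectiveDimensionLT N m :=
    prop_of_conn_eq_zero _ (fun M hM => by
        have := hM.hasProjectiveDimensionLT_zero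
        exact hasProjectiveDimensionLT_of_ge M 0 m (Nat.zero_le m))
      (fun S hS h₁ h₃ => hS.hasProjectiveDimensionLT_X₂ m h₁ h₃) hS
  let f := toStair hη M
  have hf : IsIso (f.seq.app ⊤) := isIso_toStair_app_top hη M
  let e := Abelian.factorThruImage f
  let i := Abelian.image.ι f
  have hei : e.seq.app ⊤ ≫ i.seq.app ⊤ = f.seq.app ⊤ :=
    congrArg (fun t => (Hom.seq t).app ⊤) (Abelian.image.fac f)
  have he : (ShortComplex.mk (kernel.ι e) e (kernel.condition e)).ShortExact :=
    { exact := ShortComplex.exact_kernel e }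
  have hi : (ShortComplex.mk i (cokernel.π f) (kernel.condition _)).ShortExact :=
    { exact := ShortComplex.exact_kernel (cokernel.π f) }
  have hK : HasProjectiveDimensionLT (kernel e) m := by
    refine key _ (conn_eq_zero_of_isZero ?_)
    have : Mono (e.seq.app ⊤) := by
      have : Mono (e.seq.app ⊤ ≫ i.seq.app ⊤) := by rw [hei]; infer_instance
      exact mono_of_mono _ (i.seq.app ⊤)
    have h₀ : (kernel.ι e ≫ e).seq.app ⊤ = 0 := by rw [kernel.condition]; rfl
    exact IsZero.of_mono_eq_zero ((kernel.ι e).seq.app ⊤)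
      ((cancel_mono (e.seq.app ⊤)).1 (h₀.trans zero_comp.symm))
  have hQ : HasProjectiveDimensionLT (cokernel f) m := by
    refine key _ (conn_eq_zero_of_isZero ?_)
    have h₀ : (f ≫ cokernel.π f).seq.app ⊤ = 0 := by rw [cokernel.condition]; rfl
    exact IsZero.of_epi_eq_zero ((cokernel.π f).seq.app ⊤)
      ((cancel_epi (f.seq.app ⊤)).1 (h₀.trans comp_zero.symm))
  have hI : HasProjectiveDimensionLT (Abelian.image f) m :=
    hi.hasProjectiveDimensionLT_X₁ m (hasProjectiveDimensionLT_stair hη (Nat.zero_le p) hC _)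
      (hQ.of_le m.le_succ)
  exact he.hasProjectiveDimensionLT_X₂ m hK hI

/-- The morphism from the cokernel of `η(X)` induced by a morphism from `X` to an object of `𝒜_η`. -/
noncomputable def cokernelAppDesc {X : C} {Y : VanishingCat η} (f : X ⟶ Y.obj) :
    cokernelApp (η := η) X ⟶ Y :=
  ObjectProperty.homMk (cokernel.desc (η.app X) f (app_comp_eq_zero f))

lemma cokernelAppπ_comp_desc {X : C} {Y : VanishingCat η} (f : X ⟶ Y.obj) :
    cokernelAppπ X ≫ (cokernelAppDesc f).hom = f :=
  cokernel.π_desc _ _ _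

lemma epi_cokernelAppDesc {X : C} {Y : VanishingCat η} (f : X ⟶ Y.obj) [Epi f] :
    Epi (cokernelAppDesc f) := by
  have : Epi (cokernelAppπ X ≫ (vanishing η).ι.map (cokernelAppDesc f)) := by
    rw [show cokernelAppπ X ≫ (vanishing η).ι.map (cokernelAppDesc f) = f from
      cokernelAppπ_comp_desc f]
    infer_instance
  have := epi_of_epi (cokernelAppπ X) ((vanishing η).ι.map (cokernelAppDesc f))
  exact (vanishing η).ι.epi_of_epi_map this

include hη in
lemma hasProjectiveDimensionLT_interval_cokernelApp {k m : ℕ} (hk : k < p)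
    (hC : ∀ X : C, HasProjectiveDimensionLT X m) (X : C) [Mono (η.app X)] :
    HasProjectiveDimensionLT
      ((interval (F := F) (p := p) k (k + 1)).obj (cokernelApp (η := η) X)) (m + 1) :=
  (stair_shortExact hη k X).hasProjectiveDimensionLT_X₃ m
    (hasProjectiveDimensionLT_stair hη hk hC X)
    ((hasProjectiveDimensionLT_stair hη hk.le hC X).of_le m.le_succ)

/-- If `F` is an equivalence and `𝒜_η` has finite global dimension (less than some `b`), then the bound
`pd < n` passes from `𝒜` to `𝒜[η^{1/p}]`; the value of `b` is irrelevant. -/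
lemma hasProjectiveDimensionLT_of_isEquivalence [F.IsEquivalence]
    (h : ∀ X : C, ∃ (M : C) (q : M ⟶ X), Epi q ∧ Mono (η.app M)) {n b : ℕ}
    (hC : ∀ X : C, HasProjectiveDimensionLT X n)
    (hV : ∀ Y : VanishingCat η, HasProjectiveDimensionLT Y b) (M : RootObj F η p) :
    HasProjectiveDimensionLT M n := by
  have hη := map_app_eq_app_obj h
  let := HasExt.standard (VanishingCat η)
  let := HasExt.standard (RootObj F η p)
  have hC' : ∀ m, n ≤ m → ∀ X : C, HasProjectiveDimensionLT X m := fun m hm X => (hC X).of_le hm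
  -- The bound `n + (b + 1)` from dimension shifting is lowered to `n` in `b + 1` steps.
  suffices hS : ∀ d : ℕ, ∀ (k : Fin p) (Y : VanishingCat η), d ≤ b + 1 →
      HasProjectiveDimensionLT ((interval (F := F) (p := p) k (k + 1)).obj Y)
        (n + (b + 1 - d)) from
    hasProjectiveDimensionLT_of_interval hη hC (fun k Y => by simpa using hS (b + 1) k Y le_rfl) M
  intro d
  induction d with
  | zero =>
    intro k Y _
    have := hasProjectiveDimensionLT_obj_of_epi_cover (interval (F := F) (η := η) (p := p) k (k + 1))
      b n hV (fun Y => by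
        obtain ⟨X, q, hq, hX⟩ := h Y.obj
        exact ⟨_, cokernelAppDesc q, epi_cokernelAppDesc q,
          hasProjectiveDimensionLT_interval_cokernelApp hη k.2 hC X⟩) Y
    rwa [show n + (b + 1 - 0) = b + (n + 1) by lia]
  | succ d ih =>
    intro k Y hd
    have hM := hasProjectiveDimensionLT_of_interval hη
      (hC' (n + (b + 1 - d)) (Nat.le_add_right _ _)) fun k Y => ih k Y (by lia)
    let X := F.objPreimage Y.obj
    let g : Y.obj ≅ F.obj X := (F.objObjPreimageIso Y.obj).symm
    have hX : η.app X = 0 := by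
      apply F.map_injective
      rw [hη, F.map_zero]
      have e : F.map g.hom ≫ η.app (F.obj X) = η.app Y.obj ≫ g.hom := η.naturality g.hom
      have hY : η.app Y.obj = 0 := Y.property
      exact (cancel_epi (F.map g.hom)).1 (by rw [e, hY, zero_comp, comp_zero])
    let f := simpleToStair (p := p) hη k hX g.hom
    have : Mono f := mono_simpleToStair hη k hX g.hom
    have hf : (ShortComplex.mk f (cokernel.π f) (cokernel.condition f)).ShortExact :=
      { exact := ShortComplex.exact_cokernel f }
    refine hf.hasProjectiveDimensionLT_X₁ _
      (hasProjectiveDimensionLT_stair hη k.2 (hC' _ (Nat.le_add_right _ _)) X) ?_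
    rw [show n + (b + 1 - (d + 1)) + 1 = n + (b + 1 - d) by lia]
    exact hM _

end Dimension

/-! ### The case `F = 0` -/

section Zero

variable {B : Type u} [Category.{v} B] [Abelian B] {p : ℕ} [NeZero p]

instance : PreservesFiniteLimits (zeroFunctor B) :=
  ⟨fun _ _ _ => Functor.preservesLimitsOfShape_of_isZero _ (isZero_zeroFunctor B) _⟩

/-- Here `η(Y)` is a morphism with source zero, so it is mono, and its cokernel is `Y`. -/
lemma hasProjectiveDimensionLT_zeroTrans {m : ℕ} (hB : ∀ Y : B, HasProjectiveDimensionLT Y m)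
    (N : RootObj (zeroFunctor B) (zeroTrans B) p) : HasProjectiveDimensionLT N (m + 1) := by
  have h₀ : ∀ X : B, IsZero ((zeroFunctor B).obj X) := (isZero_zeroFunctor B).obj
  refine hasProjectiveDimensionLT_of_interval (fun X => (h₀ _).eq_of_tgt _ _)
    (fun X => (hB X).of_le m.le_succ) (fun k Y => ?_) N
  · have hm : Mono ((zeroTrans B).app Y.obj) := ⟨fun _ _ _ => (h₀ _).eq_of_tgt _ _⟩
    have := hasProjectiveDimensionLT_interval_cokernelApp (η := zeroTrans B) (p := p)
      (fun X => (h₀ _).eq_of_tgt _ _) k.2 hB Y.obj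
    have : IsIso (cokernelAppDesc (𝟙 Y.obj)) := by
      have h : IsIso (cokernelAppπ (η := zeroTrans B) Y.obj ≫
          (vanishing (zeroTrans B)).ι.map (cokernelAppDesc (𝟙 Y.obj))) := by
        rw [show cokernelAppπ (η := zeroTrans B) Y.obj ≫
          (vanishing (zeroTrans B)).ι.map (cokernelAppDesc (𝟙 Y.obj)) = 𝟙 _ from
            cokernelAppπ_comp_desc (𝟙 Y.obj)]
        infer_instance
      have h' : IsIso (cokernelAppπ (η := zeroTrans B) Y.obj) :=
        inferInstanceAs (IsIso (cokernel.π (0 : (zeroFunctor B).obj Y.obj ⟶ Y.obj)))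
      have := IsIso.of_isIso_comp_left (cokernelAppπ (η := zeroTrans B) Y.obj)
        ((vanishing (zeroTrans B)).ι.map (cokernelAppDesc (𝟙 Y.obj)))
      exact isIso_of_reflects_iso _ (vanishing (zeroTrans B)).ι
    exact hasProjectiveDimensionLT_of_iso
      ((interval k (k + 1)).mapIso (asIso (cokernelAppDesc (𝟙 Y.obj)))) _

end Zero

/-! ### The lower bound -/

open Abelian

section LowerBound

variable {C : Type u} [Category.{v} C] [Abelian C] {F : C ⥤ C} [F.Additive]
  [PreservesFiniteLimits F] [PreservesFiniteColimits F] {η : F ⟶ 𝟭 C} {p : ℕ} [NeZero p]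

lemma isZero_interval_obj_seq_obj (Y : VanishingCat η) {k l : ℕ} {j : Fin p}
    (h : ¬ (k ≤ j ∧ (j : ℕ) < l)) : IsZero (((interval (F := F) k l).obj Y).seq.obj j) := by
  have key : ∀ b : Bool, b = false → IsZero ((cut η b).obj Y) := by
    rintro _ rfl
    exact isZero_cut_false Y
  exact key (inside k l j) (by rwa [← Bool.not_eq_true, inside_eq_true_iff])

lemma isIso_cutMap (Y : VanishingCat η) {a b : Bool} (h : a = b) : IsIso (cutMap Y a b) := by
  subst h
  rw [cutMap_self]
  infer_instance

lemma eq_zero_of_cut_map_eq_zero {Y Y' : VanishingCat η} {f : Y ⟶ Y'} {b : Bool} (hb : b = true)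
    (hf : (cut η b).map f = 0) : f = 0 := by
  subst hb
  exact (vanishing η).ι.map_injective (hf.trans ((vanishing η).ι.map_zero _ _).symm)

/-- A morphism `interval 0 1 Y ⟶ interval 0 2 Y'` is zero at the position `0`, because
`interval 0 1 Y` vanishes at the position `1` while `interval 0 2 Y'` has an identity as its transition
morphism from `0` to `1`. -/
lemma eq_zero_of_interval_map_eq (hp : 2 ≤ p) {Y Y' : VanishingCat η} (f : Y ⟶ Y')
    (g : (interval (F := F) (p := p) 0 1).obj Y ⟶ (interval 0 2).obj Y')
    (hg : g ≫ (intervalπ η p 0 one_le_two).app Y' = (interval 0 1).map f) : f = 0 := by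
  let i₀ : Fin p := ⟨0, by lia⟩
  let i₁ : Fin p := ⟨1, by lia⟩
  have h₀₁ : i₀ ≤ i₁ := Nat.zero_le 1
  have h₁ : ((interval (F := F) (p := p) 0 1).obj Y).seq.map (homOfLE h₀₁) ≫ g.seq.app i₁ =
      g.seq.app i₀ ≫ cutMap Y' (inside 0 2 i₀) (inside 0 2 i₁) :=
    g.seq.naturality (homOfLE h₀₁)
  have h₂ : g.seq.app i₀ = 0 := by
    have := isIso_cutMap (F := F) Y' (a := inside 0 2 i₀) (b := inside 0 2 i₁) (by
      rw [inside_eq_true_iff.2 (by simp [i₀]), inside_eq_true_iff.2 (by simp [i₁])])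
    rw [(isZero_interval_obj_seq_obj Y (k := 0) (l := 1) (j := i₁)
      (by simp [i₁])).eq_of_tgt (((interval 0 1).obj Y).seq.map (homOfLE h₀₁)) 0, zero_comp] at h₁
    exact (cancel_mono (cutMap Y' (inside 0 2 i₀) (inside 0 2 i₁))).1 (h₁.symm.trans zero_comp.symm)
  have h₃ : g.seq.app i₀ ≫ cutMap Y' (inside 0 2 i₀) (inside 0 1 i₀) =
      (cut η (inside 0 1 i₀)).map f := congrArg (fun t => (Hom.seq t).app i₀) hg
  exact eq_zero_of_cut_map_eq_zero (inside_eq_true_iff.2 (by simp [i₀]))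
    (h₃.symm.trans ((congrArg (fun t => t ≫ _) h₂).trans zero_comp))

variable (hη : ∀ X, F.map (η.app X) = η.app (F.obj X))

lemma ext_stair_eq_zero [HasExt.{w} C] [HasExt.{w'} (RootObj F η p)] (i : Fin p) {X : C}
    {N : RootObj F η p} (hN : IsZero (N.seq.obj i)) {n : ℕ}
    (x : Ext ((stair hη i).obj X) N n) : x = 0 := by
  have h : (stairAdjunction hη i).counit.app N = 0 :=
    ((stair hη i).map_isZero hN).eq_of_src _ _
  rw [Ext.eq_mapExactFunctor_unit_comp_counit (stairAdjunction hη i) x, h, Ext.mk₀_zero]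
  exact Ext.comp_zero _ _ _ _ _

lemma epi_cokernelAppπ (X : C) : Epi (cokernelAppπ (η := η) X) :=
  inferInstanceAs (Epi (cokernel.π (η.app X)))

lemma exists_eq_stairToInterval (i : Fin p) {X : C} {Y : VanishingCat η}
    (f : (stair (p := p) hη i).obj X ⟶ (interval (F := F) (p := p) i (i + 1)).obj Y) :
    ∃ g : X ⟶ Y.obj, f = stairToInterval hη i (i + 1) g := by
  have key : ∀ (a b : Bool) (f : (twist F a).obj X ⟶ (cut η b).obj Y), a = true → b = true →
      ∃ g : X ⟶ Y.obj, f = twistCut g a b := by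
    rintro _ _ f rfl rfl
    exact ⟨f, rfl⟩
  obtain ⟨g, hg⟩ := key (step i i) (inside i (i + 1) i) (f.seq.app i)
    (step_eq_true_iff.2 le_rfl) (inside_self_iff.2 rfl)
  refine ⟨g, ?_⟩
  ext j
  by_cases hj : j = i
  · subst hj
    exact hg
  · refine (isZero_interval_obj_seq_obj Y fun h => hj ?_).eq_of_tgt _ _
    exact inside_self_iff.1 (inside_eq_true_iff.2 h)

lemma stairMap_comp_stairToInterval_of_le {k l : ℕ} (hkl : k ≤ l) (m : ℕ) {X : C}
    {Y : VanishingCat η} (g : X ⟶ Y.obj) :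
    (stairMap (p := p) hη hkl).app X ≫ stairToInterval hη k m g =
      stairToInterval hη l m g ≫ (intervalι η p m hkl).app Y := by
  ext j
  refine twistCut_naturality g (step l j) (inside l m j) (step k j) (inside k m j) _ fun h h' => ?_
  rw [step_eq_true_iff] at h
  rw [← Bool.not_eq_true, inside_eq_true_iff] at h' ⊢
  lia

lemma stairToInterval_comp_intervalπ (k : ℕ) {l m : ℕ} (hlm : l ≤ m) {X : C}
    {Y : VanishingCat η} (g : X ⟶ Y.obj) :
    stairToInterval hη k m g ≫ (intervalπ η p k hlm).app Y = stairToInterval hη k l g := by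
  ext j
  have key : ∀ a b c : Bool, (c = true → b = true) →
      twistCut g a b ≫ cutMap Y b c = twistCut g a c := by
    intro a b c h
    cases c
    · exact (isZero_cut_false Y).eq_of_tgt _ _
    · obtain rfl := h rfl
      exact Category.comp_id _
  refine key (step k j) (inside k m j) (inside k l j) fun h => ?_
  rw [inside_eq_true_iff] at h ⊢
  lia

lemma stairToInterval_comp_map (k l : ℕ) {X : C} {Y Y' : VanishingCat η} (g : X ⟶ Y.obj)
    (d : Y ⟶ Y') :
    stairToInterval (p := p) hη k l g ≫ (interval k l).map d =
      stairToInterval hη k l (g ≫ d.hom) := by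
  ext j
  have key : ∀ a b : Bool, twistCut g a b ≫ (cut η b).map d = twistCut (g ≫ d.hom) a b := by
    intro a b
    cases b
    · exact (isZero_cut_false Y').eq_of_tgt _ _
    · cases a
      · exact zero_comp
      · rfl
  exact key (step k j) (inside k l j)

lemma map_comp_stairToInterval (k l : ℕ) {X X' : C} {Y : VanishingCat η} (r : X' ⟶ X)
    (g : X ⟶ Y.obj) :
    (stair (p := p) hη k).map r ≫ stairToInterval hη k l g =
      stairToInterval hη k l (r ≫ g) := by
  ext j
  have key : ∀ a b : Bool, (twist F a).map r ≫ twistCut g a b = twistCut (r ≫ g) a b := by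
    intro a b
    cases b
    · exact (isZero_cut_false Y).eq_of_tgt _ _
    · cases a
      · exact comp_zero
      · rfl
  exact key (step k j) (inside k l j)

variable [HasExt.{w} (RootObj F η p)]

/-- A morphism `g : X ⟶ Y` induces a morphism from the short exact sequence of `stair_shortExact` at
`k = 0` to that of `interval_shortExact` for `0 ≤ 1 ≤ 2`. -/
lemma extClass_comp_stairToInterval {X : C} [Mono (η.app X)] {Y : VanishingCat η}
    (g : X ⟶ Y.obj) :
    (stair_shortExact (p := p) hη 0 X).extClass.comp (Ext.mk₀ (stairToInterval hη 1 2 g))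
        (add_zero 1) =
      (Ext.mk₀ ((interval 0 1).map (cokernelAppDesc g))).comp
        (interval_shortExact zero_le_one one_le_two Y).extClass (zero_add 1) :=
  ShortComplex.ShortExact.extClass_naturality (stair_shortExact (p := p) hη 0 X)
    (interval_shortExact zero_le_one one_le_two Y)
    { τ₁ := stairToInterval hη 1 2 g
      τ₂ := stairToInterval hη 0 2 g
      τ₃ := (interval 0 1).map (cokernelAppDesc g)
      comm₁₂ := (stairMap_comp_stairToInterval_of_le hη zero_le_one 2 g).symm
      comm₂₃ := (stairToInterval_comp_intervalπ hη 0 one_le_two g).trans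
        ((stairToInterval_comp_map hη 0 1 (cokernelAppπ X) (cokernelAppDesc g)).trans
          (congrArg _ (cokernelAppπ_comp_desc g))).symm }

lemma extClass_comp_stair_map {X X' : C} [Mono (η.app X)] [Mono (η.app X')] (r : X' ⟶ X) :
    (stair_shortExact (p := p) hη 0 X').extClass.comp (Ext.mk₀ ((stair hη 1).map r))
        (add_zero 1) =
      (Ext.mk₀ ((interval 0 1).map (cokernelAppDesc (r ≫ cokernelAppπ X)))).comp
        (stair_shortExact (p := p) hη 0 X).extClass (zero_add 1) :=
  ShortComplex.ShortExact.extClass_naturality (stair_shortExact (p := p) hη 0 X')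
    (stair_shortExact (p := p) hη 0 X)
    { τ₁ := (stair hη 1).map r
      τ₂ := (stair hη 0).map r
      τ₃ := (interval 0 1).map (cokernelAppDesc (r ≫ cokernelAppπ X))
      comm₁₂ := (stairMap hη zero_le_one).naturality r
      comm₂₃ := (map_comp_stairToInterval hη 0 1 r (cokernelAppπ X)).trans
        ((stairToInterval_comp_map hη 0 1 (cokernelAppπ X') (cokernelAppDesc _)).trans
          (congrArg _ (cokernelAppπ_comp_desc _))).symm }

lemma mk₀_comp_extClass_comp_eq_zero {X X' : C} [Mono (η.app X)] [Mono (η.app X')] (r : X' ⟶ X)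
    {N : RootObj F η p} {n m : ℕ} (w : Ext ((stair hη 1).obj X) N n)
    (hw : (Ext.mk₀ ((stair hη 1).map r)).comp w (zero_add n) = 0) (h : 1 + n = m) :
    (Ext.mk₀ ((interval 0 1).map (cokernelAppDesc (r ≫ cokernelAppπ X)))).comp
      ((stair_shortExact (p := p) hη 0 X).extClass.comp w h) (zero_add m) = 0 := by
  let δ : Ext ((interval (F := F) (p := p) 0 1).obj (cokernelApp (η := η) X))
    ((stair hη 1).obj X) 1 := (stair_shortExact (p := p) hη 0 X).extClass
  let δ' : Ext ((interval (F := F) (p := p) 0 1).obj (cokernelApp (η := η) X'))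
    ((stair hη 1).obj X') 1 := (stair_shortExact (p := p) hη 0 X').extClass
  let f := (interval (F := F) (p := p) 0 1).map (cokernelAppDesc (r ≫ cokernelAppπ (η := η) X))
  have e : δ'.comp (Ext.mk₀ ((stair hη 1).map r)) (add_zero 1) =
    (Ext.mk₀ f).comp δ (zero_add 1) := extClass_comp_stair_map hη r
  change (Ext.mk₀ f).comp (δ.comp w h) (zero_add m) = 0
  rw [← Ext.comp_assoc _ _ _ (zero_add 1) h (by lia), ← e, Ext.comp_assoc_of_second_deg_zero, hw,
    Ext.comp_zero]

/-- The effaceability needed for `Ext.comp_bijective_of_effaceable`: after restriction along an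
epimorphism `coker η(X) ⟶ Y` with `η(X)` mono, a class `v` comes by the connecting map of
`stair_shortExact` from a class `w` on `stair 1 X` of degree `n`. If `n = 0`, this is a morphism,
and it is induced by some `X ⟶ Y'`; if `n > 0`, it is annihilated by an epimorphism onto `X`. -/
lemma exists_epi_mk₀_comp_eq [HasExt.{w'} C] [HasExt.{w''} (VanishingCat η)] (hp : 2 ≤ p)
    (h : ∀ X : C, ∃ (M : C) (q : M ⟶ X), Epi q ∧ Mono (η.app M)) {Y Y' : VanishingCat η} {n : ℕ}
    (v : Ext ((interval (F := F) (p := p) 0 1).obj Y) ((interval 1 2).obj Y') (n + 1)) :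
    ∃ (Z : VanishingCat η) (q : Z ⟶ Y) (g : Ext Z Y' n), Epi q ∧
      (Ext.mk₀ ((interval 0 1).map q)).comp v (zero_add _) =
        (g.mapExactFunctor (interval 0 1)).comp
          (interval_shortExact zero_le_one one_le_two Y').extClass rfl := by
  have hη := map_app_eq_app_obj h
  obtain ⟨X, q, hq, hX⟩ := h Y.obj
  have hq' := epi_cokernelAppDesc q
  obtain ⟨w, hw⟩ := Ext.contravariant_sequence_exact₃ (stair_shortExact (p := p) hη 0 X) _
    ((Ext.mk₀ ((interval 0 1).map (cokernelAppDesc q))).comp v (zero_add _))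
    (ext_stair_eq_zero hη ⟨0, by lia⟩
      (isZero_interval_obj_seq_obj Y' (by simp)) _) (add_comm 1 n)
  cases n with
  | zero =>
    obtain ⟨f, rfl⟩ := (Ext.mk₀_bijective _ _).2 w
    obtain ⟨g, rfl⟩ := exists_eq_stairToInterval hη ⟨1, by lia⟩ f
    refine ⟨_, cokernelAppDesc q, Ext.mk₀ (cokernelAppDesc g), hq', ?_⟩
    rw [← hw, Ext.mapExactFunctor_mk₀]
    exact extClass_comp_stairToInterval hη g
  | succ n =>
    let i₁ : Fin p := ⟨1, by lia⟩
    let u := (Ext.mk₀ ((stairAdjunction hη i₁).unit.app X)).comp (w.mapExactFunctor (ev F η i₁))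
      (zero_add _)
    have hu : w = (u.mapExactFunctor (stair hη 1)).comp
      (Ext.mk₀ ((stairAdjunction hη i₁).counit.app _)) (add_zero _) :=
        Ext.eq_mapExactFunctor_unit_comp_counit (stairAdjunction hη i₁) w
    obtain ⟨P, q₁, hq₁, hu₁⟩ := Ext.exists_epi_comp_eq_zero u
    obtain ⟨X', q₂, hq₂, hX'⟩ := h P
    have hr : (Ext.mk₀ ((stair (p := p) hη 1).map (q₂ ≫ q₁))).comp w (zero_add _) = 0 := by
      have e : (Ext.mk₀ (q₂ ≫ q₁)).comp u (zero_add _) = 0 := by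
        rw [← Ext.mk₀_comp_mk₀_assoc, hu₁, Ext.comp_zero]
      have e' := congrArg (Ext.mapExactFunctor (stair (p := p) hη 1)) e
      rw [Ext.mapExactFunctor_comp, Ext.mapExactFunctor_mk₀, Ext.mapExactFunctor_zero] at e'
      rw [hu]
      refine (Ext.comp_assoc_of_third_deg_zero _ _ _ _).symm.trans ?_
      exact (congrArg (fun t => Ext.comp t _ _) e').trans (Ext.zero_comp _ _ _ _ _)
    have hr' : Epi ((q₂ ≫ q₁) ≫ cokernelAppπ (η := η) X) := by
      have := epi_comp q₂ q₁
      have := epi_cokernelAppπ (η := η) X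
      exact epi_comp (q₂ ≫ q₁) (cokernelAppπ (η := η) X)
    have hc := epi_cokernelAppDesc (η := η) ((q₂ ≫ q₁) ≫ cokernelAppπ X)
    refine ⟨_, cokernelAppDesc ((q₂ ≫ q₁) ≫ cokernelAppπ X) ≫ cokernelAppDesc q, 0,
      epi_comp _ _, ?_⟩
    rw [Functor.map_comp, ← Ext.mk₀_comp_mk₀_assoc, ← hw, Ext.mapExactFunctor_zero, Ext.zero_comp]
    exact mk₀_comp_extClass_comp_eq_zero hη _ w hr (add_comm 1 (n + 1))

omit [HasExt.{w} (RootObj F η p)] in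
/-- An `Extⁿ` between objects of `𝒜_η` embeds into an `Extⁿ⁺¹` between objects of `𝒜[η^{1/p}]`. -/
lemma hasProjectiveDimensionLT_of_rootObj (hp : 2 ≤ p)
    (h : ∀ X : C, ∃ (M : C) (q : M ⟶ X), Epi q ∧ Mono (η.app M)) {m : ℕ}
    (hM : ∀ M : RootObj F η p, HasProjectiveDimensionLT M (m + 1)) (Y : VanishingCat η) :
    HasProjectiveDimensionLT Y m := by
  let := HasExt.standard C
  let := HasExt.standard (VanishingCat η)
  let := HasExt.standard (RootObj F η p)
  refine HasProjectiveDimensionLT.mk fun n hn Y' x => ?_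
  refine (Ext.comp_bijective_of_effaceable (interval (F := F) (p := p) 0 1)
    (interval_shortExact zero_le_one one_le_two Y').extClass (fun Y f => ?_) (fun Y f hf => ?_)
    (fun n Y v => exists_epi_mk₀_comp_eq hp h v) n).1 Y x
    (Ext.eq_zero_of_hasProjectiveDimensionLT
      (X := (interval (F := F) (p := p) 0 1).obj Y) _ (m + 1) (by lia))
  · ext j
    by_cases hj : (j : ℕ) < 1
    · exact (isZero_interval_obj_seq_obj Y' (by lia)).eq_of_tgt _ _
    · exact (isZero_interval_obj_seq_obj Y (by lia)).eq_of_src _ _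
  · obtain ⟨g, hg⟩ := Ext.covariant_sequence_exact₃ _
      (interval_shortExact zero_le_one one_le_two Y') _ _ hf
    obtain ⟨g, rfl⟩ := (Ext.mk₀_bijective _ _).2 g
    rw [Ext.mk₀_comp_mk₀] at hg
    exact eq_zero_of_interval_map_eq hp f g ((Ext.mk₀_bijective _ _).1 hg)

end LowerBound

lemma globalDimension_zeroTrans_le {B : Type u} [Category.{v} B] [Abelian B] {p : ℕ} [NeZero p] :
    globalDimension (RootObj (zeroFunctor B) (zeroTrans B) p) ≤ globalDimension B + 1 := by
  refine globalDimension_le_iff.2 fun n hn => ?_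
  cases n with
  | zero =>
    have hB : ∀ Y : B, IsZero Y := by
      have hB := hasProjectiveDimensionLT_of_globalDimension_lt ((le_add_one_withBot _).trans_lt hn)
      exact fun Y => (hasProjectiveDimensionLT_zero_iff_isZero _).1 (hB Y)
    exact fun N => (hasProjectiveDimensionLT_zero_iff_isZero _).2 (isZero_of_ev fun j => hB _)
  | succ n =>
    exact hasProjectiveDimensionLT_zeroTrans
      (hasProjectiveDimensionLT_of_globalDimension_lt (add_one_lt_natCast_iff.1 hn))

end RootObj

open RootObj

theorem mainTheorem4 {C : Type u} [Category.{v} C] [Abelian C]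
    (F : C ⥤ C) [F.Additive] [PreservesFiniteLimits F] [PreservesFiniteColimits F]
    [F.IsEquivalence] (η : F ⟶ 𝟭 C)
    (hη : ∀ X : C, ∃ (M : C) (q : M ⟶ X), Epi q ∧ Mono (η.app M))
    (p : ℕ) [p.AtLeastTwo] :
    globalDimension (RootObj F η p) =
        max (globalDimension C) (globalDimension (VanishingCat η) + 1) ∧
      globalDimension
          (RootObj (zeroFunctor (VanishingCat η)) (zeroTrans (VanishingCat η)) (p - 1)) ≤
        globalDimension (VanishingCat η) + 1 ∧
      ∀ (B : Type u) [Category.{v} B] [Abelian B],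
        globalDimension (RootObj (zeroFunctor B) (zeroTrans B) (p - 1)) ≤
          globalDimension B + 1 := by
  refine ⟨le_antisymm ?_ (max_le ?_ ?_), globalDimension_zeroTrans_le,
    fun B _ _ => globalDimension_zeroTrans_le⟩
  · refine globalDimension_le_iff.2 fun n hn => ?_
    obtain ⟨hC, hV⟩ := max_lt_iff.1 hn
    exact hasProjectiveDimensionLT_of_isEquivalence hη
      (hasProjectiveDimensionLT_of_globalDimension_lt hC)
      (hasProjectiveDimensionLT_of_globalDimension_lt ((le_add_one_withBot _).trans_lt hV))
  · refine globalDimension_le_iff.2 fun n hn X => ?_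
    let := CategoryTheory.HasExt.standard C
    let := CategoryTheory.HasExt.standard (RootObj F η p)
    have hη' := map_app_eq_app_obj hη
    have hX : HasProjectiveDimensionLT ((stair (p := p) hη' (⊥ : Fin p)).obj X) n :=
      hasProjectiveDimensionLT_of_globalDimension_lt hn _
    exact Abelian.hasProjectiveDimensionLT_of_obj_of_adjunction
      (stairAdjunction hη' (⊥ : Fin p)) X n
  · refine globalDimension_add_one_le fun n hn => ?_
    refine hasProjectiveDimensionLT_of_rootObj (F := F) (p := p) Nat.AtLeastTwo.prop hη fun M => ?_
    exact (hasProjectiveDimensionLT_of_globalDimension_lt hn M).of_le (by lia)
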